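/- **Proposition 3.1.** Let $k$ be an algebraically closed field of characteristic $0$, let $W$ be a $k$-vector space of dimension $6$ with a basis $x_1,\dots,x_6$, and use on $\mathbb P^{14}=\mathbb P(\Lambda^2W)$ the homogeneous coordinates given by the basis $\{x_i\wedge x_j\}_{i<j}$ of $\Lambda^2W$. The rank of a bivector $\varphi\in\Lambda^2W$ is the least dimension of a subspace $U\subset W$ with $\varphi\in\Lambda^2U$. Let $\mathbb G(1,5)\subset\mathbb P^{14}$ be the Grassmannian of vector $2$-planes $U\subset W$ in its Plücker embedding $U\mapsto\Lambda^2U$, and let $\mathcal C=\{[\varphi]\in\mathbb P^{14}\mid\varphi^3=0\}$, where powers are taken in the exterior algebra. Then: 1. $\mathbb G(1,5)=\{[\varphi]\mid \operatorname{rank}\varphi=2\}=\{[\varphi]\mid\varphi^2=0\}$, and $\mathbb G(1,5)\subset\mathbb P^{14}$ is a smooth (irreducible, closed) variety of dimension $8$ and degree $14$. 2. $\mathcal C=\{[\varphi]\mid\operatorname{rank}\varphi\le 4\}$, and $\mathcal C$ is an irreducible cubic hypersurface: it is an irreducible closed subset of $\mathbb P^{14}$ and the zero locus of an irreducible homogeneous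 polynomial of degree $3$. The set of singular points of $\mathcal C$ is exactly $\mathbb G(1,5)$. Here the dimension is the Krull dimension in the Zariski topology; the degree is $(\deg P)!$ times the leading coefficient of the Hilbert polynomial $P$; and a point $p$ of a variety $X\subset\mathbb P^{14}$ is smooth if the projective tangent space to $X$ at $p$, defined by the differentials at $p$ of all polynomials vanishing on $X$, has dimension $\dim X$, and singular otherwise. -/

import Mathlib

open scoped LinearAlgebra.Projectivization

/-! ### Projective varieties in the projective space of a vector space with a chosen basis

`V` is a `k`-vector space with a finite basis `b`, indexed by `ι`; the homogeneous coordinates of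
the point `[v]` of `ℙ k V` are the coordinates of `v` in the basis `b`, and the homogeneous
coordinate ring is `MvPolynomial ι k`. -/

section ProjectiveVarieties

variable {k V ι : Type*} [Field k] [AddCommGroup V] [Module k V]

/-- The projective zero locus of a (homogeneous) polynomial. -/
def projZeroLocus (b : Module.Basis ι k V) (F : MvPolynomial ι k) : Set (ℙ k V) :=
  {p | MvPolynomial.eval (b.repr p.rep) F = 0}

/-- The Zariski topology on projective space: its basic open sets are the complements of the zero
loci of homogeneous polynomials. -/
abbrev projZariskiTopology (b : Module.Basis ι k V) : TopologicalSpace (ℙ k V) :=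
  TopologicalSpace.generateFrom
    {U | ∃ (F : MvPolynomial ι k) (n : ℕ), F.IsHomogeneous n ∧ U = (projZeroLocus b F)ᶜ}

/-- A projective variety: an irreducible Zariski closed subset of projective space. -/
def IsProjVariety (b : Module.Basis ι k V) (X : Set (ℙ k V)) : Prop :=
  @IsClosed _ (projZariskiTopology b) X ∧ @IsIrreducible _ (projZariskiTopology b) X

/-- The dimension of a subset of projective space: the supremum of the lengths of chains of
irreducible closed subsets, in the induced Zariski topology. -/
noncomputable def projDim (b : Module.Basis ι k V) (X : Set (ℙ k V)) : WithBot ℕ∞ :=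
  @topologicalKrullDim X ((projZariskiTopology b).induced Subtype.val)

/-- The ideal of a subset `X` of projective space: the polynomials that vanish at every vector
representing a point of `X`. Over an infinite field this is a homogeneous ideal, generated by the
homogeneous polynomials vanishing on `X`. -/
def projVanishingIdeal (b : Module.Basis ι k V) (X : Set (ℙ k V)) :
    Ideal (MvPolynomial ι k) where
  carrier := {f | ∀ (v : V) (hv : v ≠ 0), Projectivization.mk k v hv ∈ X →
    MvPolynomial.eval (b.repr v) f = 0}
  add_mem' := by
    intro f g hf hg v hv hX
    rw [map_add, hf v hv hX, hg v hv hX, add_zero]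
  zero_mem' := by
    intro v hv hX
    exact map_zero _
  smul_mem' := by
    intro c f hf v hv hX
    rw [smul_eq_mul, map_mul, hf v hv hX, mul_zero]

/-- The Hilbert function of `X`: the dimension of the degree `n` part of the homogeneous
coordinate ring `k[x_i] / I(X)`. -/
noncomputable def projHilbertFunction (b : Module.Basis ι k V) (X : Set (ℙ k V)) (n : ℕ) : ℕ :=
  Module.finrank k ((MvPolynomial.homogeneousSubmodule ι k n).map
    (Ideal.Quotient.mkₐ k (projVanishingIdeal b X)).toLinearMap)

/-- `X` has degree `d`: the Hilbert function of `X` agrees, for all large arguments, with a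
polynomial `P` (the Hilbert polynomial), and `d` is `(deg P)!` times the leading coefficient
of `P`. -/
def HasProjDegree (b : Module.Basis ι k V) (X : Set (ℙ k V)) (d : ℕ) : Prop :=
  ∃ P : Polynomial ℚ,
    (∀ᶠ n : ℕ in Filter.atTop, (projHilbertFunction b X n : ℚ) = P.eval (n : ℚ)) ∧
    (P.natDegree.factorial : ℚ) * P.leadingCoeff = d

/-- The embedded Zariski tangent space to `X` at `p`, as a linear subspace of `V`: the common
kernel of the differentials at (a representative of) `p` of all polynomials in the ideal of `X`.
This is the tangent space to the affine cone over `X`; its projectivization is the projective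
tangent space to `X` at `p`. -/
noncomputable def projTangentSpace [Fintype ι] (b : Module.Basis ι k V) (X : Set (ℙ k V))
    (p : ℙ k V) : Submodule k V :=
  ⨅ f ∈ projVanishingIdeal b X,
    LinearMap.ker (∑ i, MvPolynomial.eval (b.repr p.rep) (MvPolynomial.pderiv i f) • b.coord i)

/-- The variety `X` is smooth at its point `p` (Jacobian criterion): the projective tangent space
at `p` has dimension `dim X`, that is, its linear version has dimension `dim X + 1`. -/
def IsSmoothPoint [Fintype ι] (b : Module.Basis ι k V) (X : Set (ℙ k V)) (p : ℙ k V) : Prop :=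
  p ∈ X ∧ (Module.finrank k (projTangentSpace b X p) : WithBot ℕ∞) = projDim b X + 1

/-- The set of singular points of the variety `X`. -/
def singularPoints [Fintype ι] (b : Module.Basis ι k V) (X : Set (ℙ k V)) : Set (ℙ k V) :=
  {p | p ∈ X ∧ ¬ IsSmoothPoint b X p}

/-- `X` is an irreducible hypersurface of degree `d`: the zero locus of an irreducible homogeneous
polynomial of degree `d`. -/
def IsIrreducibleHypersurface (b : Module.Basis ι k V) (X : Set (ℙ k V)) (d : ℕ) : Prop :=
  ∃ F : MvPolynomial ι k, F.IsHomogeneous d ∧ Irreducible F ∧ X = projZeroLocus b F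

end ProjectiveVarieties

/-! ### Bivectors -/

section Bivectors

variable (k W : Type*) [Field k] [AddCommGroup W] [Module k W]

/-- The rank of a bivector `φ`: the least dimension of a finite-dimensional subspace `U` of `W`
such that `φ` comes from `⋀² U`. -/
noncomputable def bivectorRank {k W : Type*} [Field k] [AddCommGroup W] [Module k W]
    (φ : ⋀[k]^2 W) : ℕ :=
  sInf {n | ∃ U : Submodule k W, Module.Finite k U ∧ Module.finrank k U = n ∧
    φ ∈ LinearMap.range (exteriorPower.map 2 U.subtype)}

/-- The Grassmannian of vector `2`-planes of `W` (projective lines of `ℙ(W)`) in its Plücker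
embedding: the `2`-plane `U` corresponds to the point of `ℙ(⋀² W)` given by the line `⋀² U`. -/
def lineGrassmannian : Set (ℙ k (⋀[k]^2 W)) :=
  {p | ∃ U : Submodule k W, Module.finrank k U = 2 ∧
    p.submodule = LinearMap.range (exteriorPower.map 2 U.subtype)}

/-- The Pfaffian locus `{[φ] | φ ^ 3 = 0}`, the power being taken in the exterior algebra. -/
def pfaffianLocus : Set (ℙ k (⋀[k]^2 W)) :=
  {p | (p.rep : ExteriorAlgebra k W) ^ 3 = 0}

end Bivectors

/-! Normal form: a bivector on a space of dimension n is a sum of at most n/2 decomposable ones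
(`isWedgeSum_of_finrank_eq`). For two summands φ² = 2 a∧b∧c∧d, for three φ³ = 6 a∧b∧c∧d∧e∧f; in
characteristic 0 such a power vanishes only if the vectors are dependent, and then one summand fewer
suffices. Hence φ² = 0 means rank at most 2 and φ³ = 0 means rank at most 4
(`pow_two_eq_zero_iff_isWedgeSum`, `pow_three_eq_zero_iff`).

Both loci are images of affine spaces under polynomial maps, so their ideals are kernels of maps
into a domain, hence prime. Both also occur in one chain of fourteen such cones with strictly
decreasing ideals (`chainType`, `projVanishingIdeal_chain_lt`). With the zero ideal and the
irrelevant ideal added, these primes form a chain of length 15 in a polynomial ring of Krull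
dimension 15. The chain is therefore as long as possible, and the position of a closed member is its
dimension: 8 and 13 (`projDim_eq_of_chain`).

Tangent spaces are computed in a basis of W adapted to the point. Lines inside the cone give tangent
vectors; the derivatives of φ² and φ³ exclude the rest. The linear dimensions are 9 on the
Grassmannian, 14 on the cubic away from it, and 15 on the cubic along it.

The Pfaffian cubic is irreducible because the prime ideal of the locus contains no nonzero
polynomial of degree at most 2 (`eq_zero_of_mem_projVanishingIdeal_pfaffianLocus`). The degree comes
from standard monomial theory: the coordinate ring of the Grassmannian is generated by the 2×2
minors of a generic 2×6 matrix, and products of minors along standard lists form a basis of its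
degree n part. Their number is a polynomial in n with leading coefficient 14/8!. -/

/-! ### Cones, vanishing ideals and irreducibility -/

section ProjectiveGeometry

variable {k V ι : Type*} [Field k] [AddCommGroup V] [Module k V]

open MvPolynomial

/-- The restriction of a polynomial function to the affine line `t ↦ v + t w`. -/
noncomputable def linePolynomial (b : Module.Basis ι k V) (f : MvPolynomial ι k) (v w : V) :
    Polynomial k :=
  aeval (fun i => Polynomial.C (b.repr v i) + Polynomial.X * Polynomial.C (b.repr w i)) f

lemma eval_linePolynomial (b : Module.Basis ι k V) (f : MvPolynomial ι k) (v w : V) (t : k) :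
    (linePolynomial b f v w).eval t = eval (b.repr (v + t • w)) f := by
  induction f using MvPolynomial.induction_on with
  | C a => simp [linePolynomial, Polynomial.algebraMap_eq]
  | add p q hp hq =>
    simp only [linePolynomial] at hp hq ⊢
    simp only [map_add, Polynomial.eval_add, hp, hq]
  | mul_X p i hp =>
    simp only [linePolynomial] at hp ⊢
    simp only [map_mul, Polynomial.eval_mul, hp]
    simp [mul_comm t]

/-- Restriction to lines turns the differential into a derivative in one variable; all tangent space
computations go through this. -/
lemma eval_zero_derivative_linePolynomial [Fintype ι] (b : Module.Basis ι k V) (f : MvPolynomial ι k)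
    (v w : V) :
    (linePolynomial b f v w).derivative.eval 0 =
      (∑ i, eval (b.repr v) (pderiv i f) • b.coord i) w := by
  classical
  have h0 : ∀ f, (linePolynomial b f v w).eval 0 = eval (b.repr v) f := fun f => by
    rw [eval_linePolynomial, zero_smul, add_zero]
  induction f using MvPolynomial.induction_on with
  | C a => simp [linePolynomial, Polynomial.algebraMap_eq]
  | add p q hp hq =>
    have : linePolynomial b (p + q) v w = linePolynomial b p v w + linePolynomial b q v w := by
      simp [linePolynomial]
    rw [this]
    simp only [Polynomial.eval_add, hp, hq, map_add, add_smul,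
      Finset.sum_add_distrib, LinearMap.add_apply]
  | mul_X p i hp =>
    have : linePolynomial b (p * X i) v w = linePolynomial b p v w *
        (Polynomial.C (b.repr v i) + Polynomial.X * Polynomial.C (b.repr w i)) := by
      simp [linePolynomial]
    rw [this]
    have hX : ∀ j, eval (b.repr v) (pderiv j (p * X i)) =
        eval (b.repr v) (pderiv j p) * b.repr v i + if j = i then eval (b.repr v) p else 0 := by
      intro j
      rw [Derivation.leibniz, pderiv_X]
      by_cases h : j = i
      · subst h; simp; ring
      · simp [h, Ne.symm h, mul_comm]
    simp only [hX, add_smul, Finset.sum_add_distrib, ite_smul, zero_smul, Finset.sum_ite_eq',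
      Finset.mem_univ, if_true, LinearMap.add_apply, mul_smul, Polynomial.derivative_mul,
      Polynomial.eval_add, Polynomial.eval_mul, hp, h0]
    simp only [LinearMap.sum_apply, LinearMap.smul_apply, Module.Basis.coord_apply, smul_eq_mul,
      Polynomial.eval_C, Polynomial.eval_X, zero_mul, add_zero, Polynomial.derivative_add,
      Polynomial.derivative_C, Polynomial.derivative_X, Polynomial.derivative_mul, mul_zero,
      zero_add, one_mul, Finset.sum_mul]
    congr 1
    exact Finset.sum_congr rfl fun j _ => by ring

/-- The points of projective space represented by vectors in `T`. -/
def coneLocus (T : Set V) : Set (ℙ k V) := {p | p.rep ∈ T}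

/-- `T` is stable under scalar multiplication. -/
def IsCone (k : Type*) {V : Type*} [Field k] [AddCommGroup V] [Module k V] (T : Set V) : Prop :=
  ∀ (c : k), ∀ v ∈ T, c • v ∈ T

lemma mk_mem_coneLocus {T : Set V} (hT : IsCone k T) {v : V} (hv : v ≠ 0) :
    Projectivization.mk k v hv ∈ coneLocus (k := k) T ↔ v ∈ T := by
  obtain ⟨a, ha⟩ := Projectivization.exists_smul_eq_mk_rep k v hv
  simp only [coneLocus, Set.mem_ofPred_eq]
  rw [← ha]
  refine ⟨fun h => ?_, fun h => hT a v h⟩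
  have := hT (a⁻¹ : kˣ) _ h
  simpa [Units.smul_def, smul_smul] using this

lemma linePolynomial_eq_zero_of_forall_ne [Infinite k] {p : Polynomial k}
    (h : ∀ t : k, t ≠ 0 → p.eval t = 0) : p = 0 := by
  refine Polynomial.eq_zero_of_infinite_isRoot _ (Set.Infinite.mono (s := {0}ᶜ) ?_ ?_)
  · intro t ht
    exact h t ht
  · exact (Set.finite_singleton (0 : k)).infinite_compl

/-- On the line through 0 and a point of the cone, f vanishes away from 0, hence also at 0 because k
is infinite. The ideal of the empty set is the whole ring, so nonemptiness matters. -/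
lemma eval_zero_of_mem_projVanishingIdeal [Infinite k] {b : Module.Basis ι k V} {X : Set (ℙ k V)}
    (hX : X.Nonempty) {f : MvPolynomial ι k} (hf : f ∈ projVanishingIdeal b X) :
    eval (0 : ι → k) f = 0 := by
  obtain ⟨p, hp⟩ := hX
  induction p using Projectivization.ind with
  | h v hv =>
  have h : linePolynomial b f 0 v = 0 := by
    apply linePolynomial_eq_zero_of_forall_ne
    intro t ht
    rw [eval_linePolynomial, zero_add]
    refine hf _ (smul_ne_zero ht hv) ?_
    convert hp using 1
    rw [Projectivization.mk_eq_mk_iff']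
    exact ⟨t, rfl⟩
  have := eval_linePolynomial b f 0 v 0
  rw [h] at this
  simpa using this.symm

lemma mem_projVanishingIdeal_coneLocus [Infinite k] {b : Module.Basis ι k V} {T : Set V}
    (hT : IsCone k T) (hne : ∃ v ∈ T, v ≠ 0) {f : MvPolynomial ι k} :
    f ∈ projVanishingIdeal b (coneLocus T) ↔ ∀ v ∈ T, eval (b.repr v) f = 0 := by
  constructor
  · intro hf v hv
    by_cases h0 : v = 0
    · subst h0
      obtain ⟨w, hw, hw0⟩ := hne
      have := eval_zero_of_mem_projVanishingIdeal (b := b)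
        ⟨_, (mk_mem_coneLocus hT hw0).2 hw⟩ hf
      simpa using this
    · exact hf v h0 ((mk_mem_coneLocus hT h0).2 hv)
  · intro h v hv hX
    exact h v ((mk_mem_coneLocus hT hv).1 hX)

/-- If the cone `T` is the image of a polynomial map, then the ideal of the corresponding
projective set is the kernel of the pullback of polynomials. -/
lemma projVanishingIdeal_coneLocus_eq_ker [Infinite k] {σ : Type*} {b : Module.Basis ι k V}
    {T : Set V} (hT : IsCone k T) (hne : ∃ v ∈ T, v ≠ 0) (g : ι → MvPolynomial σ k)
    (hg : ∀ v ∈ T, ∃ y : σ → k, ∀ i, b.repr v i = eval y (g i))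
    (hg' : ∀ y : σ → k, ∃ v ∈ T, ∀ i, b.repr v i = eval y (g i)) :
    projVanishingIdeal b (coneLocus T) = RingHom.ker (aeval (R := k) g) := by
  ext f
  rw [mem_projVanishingIdeal_coneLocus hT hne, RingHom.mem_ker]
  have key : ∀ (y : σ → k) (v : V), (∀ i, b.repr v i = eval y (g i)) →
      eval (b.repr v) f = eval y (aeval g f) := by
    intro y v h
    induction f using MvPolynomial.induction_on with
    | C a => simp
    | add p q hp hq => simp [hp, hq]
    | mul_X p i hp => simp [hp, h i]
  constructor
  · intro h
    refine MvPolynomial.funext fun y => ?_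
    obtain ⟨v, hv, hy⟩ := hg' y
    rw [← key y v hy, h v hv, map_zero]
  · intro h v hv
    obtain ⟨y, hy⟩ := hg v hv
    rw [key y v hy, h, map_zero]

lemma MvPolynomial.IsHomogeneous.eval_smul {F : MvPolynomial ι k} {n : ℕ}
    (hF : F.IsHomogeneous n) (c : k) (y : ι → k) : eval (c • y) F = c ^ n * eval y F := by
  rw [eval_eq, eval_eq, Finset.mul_sum]
  refine Finset.sum_congr rfl fun d hd => ?_
  have hd' := hF.degree_eq_sum_deg_support hd
  simp only [Pi.smul_apply, smul_eq_mul, mul_pow, Finset.prod_mul_distrib]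
  rw [Finset.prod_pow_eq_pow_sum, ← hd']
  ring

lemma mem_projZeroLocus_mk {b : Module.Basis ι k V} {F : MvPolynomial ι k} {n : ℕ}
    (hF : F.IsHomogeneous n) {v : V} (hv : v ≠ 0) :
    Projectivization.mk k v hv ∈ projZeroLocus b F ↔ eval (b.repr v) F = 0 := by
  obtain ⟨a, ha⟩ := Projectivization.exists_smul_eq_mk_rep k v hv
  have : eval (b.repr (a • v)) F = (a : k) ^ n * eval (b.repr v) F := by
    rw [Units.smul_def, map_smul, Finsupp.coe_smul, hF.eval_smul]
  simp only [projZeroLocus, Set.mem_ofPred_eq]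
  rw [← ha, this, mul_eq_zero, or_iff_right (pow_ne_zero _ a.ne_zero)]

lemma mem_projVanishingIdeal_iff {b : Module.Basis ι k V} {X : Set (ℙ k V)}
    {F : MvPolynomial ι k} {n : ℕ} (hF : F.IsHomogeneous n) :
    F ∈ projVanishingIdeal b X ↔ X ⊆ projZeroLocus b F := by
  constructor
  · intro h p hp
    induction p using Projectivization.ind with
    | h v hv => exact (mem_projZeroLocus_mk hF hv).2 (h v hv hp)
  · intro h v hv hp
    exact (mem_projZeroLocus_mk hF hv).1 (h hp)

lemma isClosed_projZeroLocus (b : Module.Basis ι k V) {F : MvPolynomial ι k} {n : ℕ}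
    (hF : F.IsHomogeneous n) : @IsClosed _ (projZariskiTopology b) (projZeroLocus b F) := by
  let := projZariskiTopology b
  rw [← isOpen_compl_iff]
  exact TopologicalSpace.isOpen_generateFrom_of_mem ⟨F, n, hF, rfl⟩

lemma isTopologicalBasis_projZariskiTopology (b : Module.Basis ι k V) :
    @TopologicalSpace.IsTopologicalBasis _ (projZariskiTopology b)
      {U | ∃ (F : MvPolynomial ι k) (n : ℕ), F.IsHomogeneous n ∧ U = (projZeroLocus b F)ᶜ} := by
  let := projZariskiTopology b
  refine ⟨?_, ?_, rfl⟩
  · rintro _ ⟨F, n, hF, rfl⟩ _ ⟨G, m, hG, rfl⟩ p hp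
    refine ⟨_, ⟨F * G, n + m, hF.mul hG, rfl⟩, ?_, ?_⟩
    · simpa [projZeroLocus] using hp
    · intro q hq
      simpa [projZeroLocus] using hq
  · refine Set.eq_univ_of_forall fun p => ?_
    exact ⟨_, ⟨1, 0, isHomogeneous_one _ _, rfl⟩, by simp [projZeroLocus]⟩

/-- A closed set is cut out by the homogeneous polynomials vanishing on it. -/
lemma exists_notMem_projZeroLocus {b : Module.Basis ι k V} {Z : Set (ℙ k V)}
    (hZ : @IsClosed _ (projZariskiTopology b) Z) {p : ℙ k V} (hp : p ∉ Z) :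
    ∃ (F : MvPolynomial ι k) (n : ℕ), F.IsHomogeneous n ∧ F ∈ projVanishingIdeal b Z ∧
      p ∉ projZeroLocus b F := by
  let := projZariskiTopology b
  obtain ⟨_, ⟨F, n, hF, rfl⟩, hpF, hFZ⟩ :=
    (isTopologicalBasis_projZariskiTopology b).exists_subset_of_mem_open
      (show p ∈ Zᶜ from hp) hZ.isOpen_compl
  exact ⟨F, n, hF, (mem_projVanishingIdeal_iff hF).2 (Set.compl_subset_compl.1 hFZ), hpF⟩

lemma projVanishingIdeal_anti (b : Module.Basis ι k V) {Z Z' : Set (ℙ k V)} (h : Z ⊆ Z') :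
    projVanishingIdeal b Z' ≤ projVanishingIdeal b Z :=
  fun _ hf v hv hZ => hf v hv (h hZ)

lemma projVanishingIdeal_lt {b : Module.Basis ι k V} {Z Z' : Set (ℙ k V)}
    (hZ : @IsClosed _ (projZariskiTopology b) Z) (h : Z ⊂ Z') :
    projVanishingIdeal b Z' < projVanishingIdeal b Z := by
  refine lt_of_le_of_ne (projVanishingIdeal_anti b h.subset) fun he => ?_
  obtain ⟨p, hp, hpZ⟩ := Set.exists_of_ssubset h
  obtain ⟨F, n, hF, hFZ, hpF⟩ := exists_notMem_projZeroLocus hZ hpZ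
  exact hpF ((mem_projVanishingIdeal_iff hF).1 (he ▸ hFZ) hp)

lemma isIrreducible_of_isPrime_projVanishingIdeal {b : Module.Basis ι k V} {X : Set (ℙ k V)}
    (hX : (projVanishingIdeal b X).IsPrime) : @IsIrreducible _ (projZariskiTopology b) X := by
  let := projZariskiTopology b
  constructor
  · by_contra h
    rw [Set.not_nonempty_iff_eq_empty] at h
    subst h
    exact hX.ne_top ((Ideal.eq_top_iff_one _).2 fun v hv h => h.elim)
  · intro u v hu hv ⟨p, hpX, hpu⟩ ⟨q, hqX, hqv⟩
    have hB := isTopologicalBasis_projZariskiTopology b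
    obtain ⟨_, ⟨F, n, hF, rfl⟩, hpF, hFu⟩ := hB.exists_subset_of_mem_open hpu hu
    obtain ⟨_, ⟨G, m, hG, rfl⟩, hqG, hGv⟩ := hB.exists_subset_of_mem_open hqv hv
    have hFG : F * G ∉ projVanishingIdeal b X := by
      intro h
      rcases hX.mem_or_mem h with h | h
      · exact hpF ((mem_projVanishingIdeal_iff hF).1 h hpX)
      · exact hqG ((mem_projVanishingIdeal_iff hG).1 h hqX)
    rw [mem_projVanishingIdeal_iff (hF.mul hG), Set.not_subset] at hFG
    obtain ⟨r, hrX, hr⟩ := hFG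
    have hr' : r ∈ (projZeroLocus b F)ᶜ ∧ r ∈ (projZeroLocus b G)ᶜ := by
      simpa [projZeroLocus] using hr
    exact ⟨r, hrX, hFu hr'.1, hGv hr'.2⟩

/-- As a function of t, f(tv) is a polynomial whose coefficients are the values at v of the
homogeneous components, and it vanishes for all t ≠ 0. -/
lemma homogeneousComponent_mem_projVanishingIdeal [Infinite k] {b : Module.Basis ι k V}
    {X : Set (ℙ k V)} {f : MvPolynomial ι k} (hf : f ∈ projVanishingIdeal b X) (n : ℕ) :
    homogeneousComponent n f ∈ projVanishingIdeal b X := by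
  intro v hv hX
  have hev : ∀ (m : ℕ) (t : k), eval (b.repr (t • v)) (homogeneousComponent m f) =
      t ^ m * eval (b.repr v) (homogeneousComponent m f) := by
    intro m t
    rw [map_smul, Finsupp.coe_smul, (homogeneousComponent_isHomogeneous m f).eval_smul]
  have h : ∑ m ∈ Finset.range (f.totalDegree + 1),
      Polynomial.C (eval (b.repr v) (homogeneousComponent m f)) * Polynomial.X ^ m = 0 := by
    apply linePolynomial_eq_zero_of_forall_ne
    intro t ht
    have h1 : eval (b.repr (t • v)) f = 0 := by
      refine hf _ (smul_ne_zero ht hv) ?_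
      convert hX using 1
      rw [Projectivization.mk_eq_mk_iff']
      exact ⟨t, rfl⟩
    rw [← sum_homogeneousComponent f, map_sum] at h1
    rw [← h1, Polynomial.eval_finsetSum]
    refine Finset.sum_congr rfl fun m _ => ?_
    rw [hev, Polynomial.eval_mul, Polynomial.eval_C, Polynomial.eval_pow, Polynomial.eval_X,
      mul_comm]
  by_cases hn : n ∈ Finset.range (f.totalDegree + 1)
  · have := congrArg (Polynomial.coeff · n) h
    simpa [Polynomial.finsetSum_coeff, Polynomial.coeff_C_mul, Polynomial.coeff_X_pow,
      Finset.mem_range.1 hn] using this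
  · rw [homogeneousComponent_eq_zero _ _ (by simpa using hn), map_zero]

lemma isPrime_projVanishingIdeal [Infinite k] {b : Module.Basis ι k V} {X : Set (ℙ k V)}
    (hX : @IsIrreducible _ (projZariskiTopology b) X) : (projVanishingIdeal b X).IsPrime := by
  classical
  let := projZariskiTopology b
  let := gradedAlgebra (σ := ι) (R := k)
  have hhom : (projVanishingIdeal b X).IsHomogeneous (homogeneousSubmodule ι k) := by
    intro n f hf
    have := homogeneousComponent_mem_projVanishingIdeal hf n
    rwa [← decomposition.decompose'_apply] at this
  -- For a homogeneous ideal, primality need only be tested on homogeneous elements, whose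
  -- non-vanishing loci are open.
  apply hhom.isPrime_of_homogeneous_mem_or_mem
  · obtain ⟨p, hp⟩ := hX.1
    intro h
    have h1 : (1 : MvPolynomial ι k) ∈ projVanishingIdeal b X := h ▸ Submodule.mem_top
    have := eval_zero_of_mem_projVanishingIdeal ⟨p, hp⟩ h1
    simp at this
  · rintro F G ⟨n, hF⟩ ⟨m, hG⟩ hFG
    by_contra hcon
    rw [not_or, mem_projVanishingIdeal_iff hF, mem_projVanishingIdeal_iff hG, Set.not_subset,
      Set.not_subset] at hcon
    obtain ⟨⟨p, hp, hpF⟩, ⟨q, hq, hqG⟩⟩ := hcon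
    obtain ⟨r, hr, hrF, hrG⟩ := hX.2 _ _ (isClosed_projZeroLocus b hF).isOpen_compl
      (isClosed_projZeroLocus b hG).isOpen_compl ⟨p, hp, hpF⟩ ⟨q, hq, hqG⟩
    have := (mem_projVanishingIdeal_iff (IsHomogeneous.mul hF hG)).1 hFG hr
    simp only [projZeroLocus, Set.mem_ofPred_eq, map_mul, mul_eq_zero] at this
    exact this.elim hrF hrG

end ProjectiveGeometry

/-! ### Dimension from a chain of primes of maximal length -/

section Dimension

variable {k V ι : Type*} [Field k] [AddCommGroup V] [Module k V]

open MvPolynomial TopologicalSpace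

lemma isPreirreducible_preimage_subtype_val {Y : Type*} [TopologicalSpace Y] {X Z : Set Y}
    (hZX : Z ⊆ X) (hZ : IsPreirreducible Z) :
    IsPreirreducible (Subtype.val ⁻¹' Z : Set X) := by
  rintro _ _ ⟨U, hU, rfl⟩ ⟨U', hU', rfl⟩ ⟨p, hp, hpU⟩ ⟨q, hq, hqU⟩
  obtain ⟨r, hr, hrU⟩ := hZ U U' hU hU' ⟨p, hp, hpU⟩ ⟨q, hq, hqU⟩
  exact ⟨⟨r, hZX hr⟩, hr, hrU⟩

/-- Lets `projDim_eq_of_chain` use chain members that are not known to be closed. -/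
lemma projVanishingIdeal_closure [Infinite k] (b : Module.Basis ι k V) (X : Set (ℙ k V)) :
    projVanishingIdeal b (@closure _ (projZariskiTopology b) X) = projVanishingIdeal b X := by
  let := projZariskiTopology b
  refine le_antisymm (projVanishingIdeal_anti b subset_closure) fun f hf => ?_
  rw [← sum_homogeneousComponent f]
  refine Ideal.sum_mem _ fun n _ => ?_
  have hn := homogeneousComponent_isHomogeneous n f
  exact (mem_projVanishingIdeal_iff hn).2 (closure_minimal ((mem_projVanishingIdeal_iff hn).1
    (homogeneousComponent_mem_projVanishingIdeal hf n)) (isClosed_projZeroLocus b hn))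

/-- The prime ideal of an irreducible closed subset of projective space. -/
def irreducibleClosedsPrime [Infinite k] (b : Module.Basis ι k V)
    (Z : @IrreducibleCloseds _ (projZariskiTopology b)) : PrimeSpectrum (MvPolynomial ι k) :=
  let := projZariskiTopology b
  ⟨projVanishingIdeal b (Z : Set (ℙ k V)), isPrime_projVanishingIdeal Z.isIrreducible⟩

/-- The maximal ideal of polynomials without constant term. -/
noncomputable def irrelevantPrime (k ι : Type*) [Field k] : PrimeSpectrum (MvPolynomial ι k) :=
  ⟨RingHom.ker (eval (0 : ι → k)), RingHom.ker_isPrime _⟩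

lemma projVanishingIdeal_lt_irrelevant [Infinite k] (b : Module.Basis ι k V) {X : Set (ℙ k V)}
    (hX : X.Nonempty) : projVanishingIdeal b X < (irrelevantPrime k ι).asIdeal := by
  refine lt_of_le_of_ne (fun f hf => eval_zero_of_mem_projVanishingIdeal hX hf) fun h => ?_
  obtain ⟨p, hp⟩ := hX
  refine p.rep_nonzero (b.ext_elem fun i => ?_)
  have hi : (MvPolynomial.X i : MvPolynomial ι k) ∈ (irrelevantPrime k ι).asIdeal := by
    simp [irrelevantPrime]
  rw [← h] at hi
  have := hi p.rep p.rep_nonzero (by rwa [p.mk_rep])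
  simpa using this

-- Passing to ideals reverses strict inclusions, and the irrelevant ideal lies strictly above the
-- ideal of every nonempty set. Adjoining it as a bottom element below the irreducible closed sets
-- produces the extra 1, the difference between a projective set and its cone.
open Classical in
lemma height_add_one_le_coheight [Infinite k] (b : Module.Basis ι k V)
    (Z : @IrreducibleCloseds _ (projZariskiTopology b)) :
    Order.height Z + 1 ≤ Order.coheight (irreducibleClosedsPrime b Z) := by
  let := projZariskiTopology b
  let f : WithBot (IrreducibleCloseds (ℙ k V)) → (PrimeSpectrum (MvPolynomial ι k))ᵒᵈ :=
    fun Z => Z.recBotCoe (OrderDual.toDual (irrelevantPrime k ι))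
      (fun Z => OrderDual.toDual (irreducibleClosedsPrime b Z))
  have hf : StrictMono f := by
    intro Z Z' h
    induction Z' with
    | bot => exact absurd h not_lt_bot
    | coe Z' =>
      induction Z with
      | bot =>
        change irreducibleClosedsPrime b Z' < irrelevantPrime k ι
        exact projVanishingIdeal_lt_irrelevant b Z'.isIrreducible.nonempty
      | coe Z =>
        change irreducibleClosedsPrime b Z' < irreducibleClosedsPrime b Z
        exact projVanishingIdeal_lt Z.isClosed (show Z < Z' from WithBot.coe_lt_coe.1 h)
  have := Order.height_le_height_apply_of_strictMono f hf Z
  rwa [Order.height_coe_withBot] at this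

/-- The primes of `S m`, ..., `S N` followed by the zero ideal form a descending chain with N + 1 -
m steps. -/
lemma le_height_of_chain (b : Module.Basis ι k V) {N : ℕ} (S : ℕ → Set (ℙ k V))
    (hprime : ∀ m ≤ N, (projVanishingIdeal b (S m)).IsPrime)
    (hlt : ∀ m < N, projVanishingIdeal b (S (m + 1)) < projVanishingIdeal b (S m))
    (hbot : projVanishingIdeal b (S N) ≠ ⊥) (d m : ℕ) (hdm : m + d = N + 1)
    (P : PrimeSpectrum (MvPolynomial ι k)) (hP : P.asIdeal = projVanishingIdeal b (S m)) :
    (d : ℕ∞) ≤ Order.height P := by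
  induction d generalizing m P with
  | zero => simp
  | succ d ih =>
    rcases Nat.lt_or_ge m N with h | h
    · let Q : PrimeSpectrum (MvPolynomial ι k) := ⟨_, hprime (m + 1) h⟩
      have hQP : Q < P := by
        change Q.asIdeal < P.asIdeal
        rw [hP]
        exact hlt m h
      have h1 := ih (m + 1) (by omega) Q rfl
      have h2 := Order.height_add_one_le hQP
      push_cast
      exact le_trans (by gcongr) h2
    · obtain rfl : d = 0 := by omega
      obtain rfl : m = N := by omega
      let Q : PrimeSpectrum (MvPolynomial ι k) := ⟨⊥, Ideal.isPrime_bot⟩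
      have hQP : Q < P := by
        change (⊥ : Ideal _) < P.asIdeal
        rw [hP]
        exact bot_lt_iff_ne_bot.2 hbot
      have h2 := Order.height_add_one_le hQP
      refine le_trans ?_ h2
      simp

/-- In a projective space with `N + 2` homogeneous coordinates, a maximal chain of irreducible
subsets computes the dimension of those among them that are closed. -/
lemma projDim_eq_of_chain [Infinite k] [Finite ι] (b : Module.Basis ι k V) {N : ℕ}
    (hN : Nat.card ι = N + 2) (S : ℕ → Set (ℙ k V))
    (hmono : Monotone S)
    (hprime : ∀ m ≤ N, (projVanishingIdeal b (S m)).IsPrime)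
    (hlt : ∀ m < N, projVanishingIdeal b (S (m + 1)) < projVanishingIdeal b (S m))
    (hbot : projVanishingIdeal b (S N) ≠ ⊥) {m : ℕ} (hm : m ≤ N)
    (hcl : @IsClosed _ (projZariskiTopology b) (S m)) : projDim b (S m) = m := by
  let := projZariskiTopology b
  have hind : Topology.IsInducing (Subtype.val : S m → ℙ k V) := .subtypeVal
  change Order.krullDim (IrreducibleCloseds (S m)) = m
  apply le_antisymm
  · rw [Order.krullDim_eq_iSup_height]
    refine iSup_le fun Z => ?_
    let Z' := IrreducibleCloseds.map _ hind.continuous Z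
    have h1 : Order.height Z ≤ Order.height Z' :=
      Order.height_le_height_apply_of_strictMono _
        (IrreducibleCloseds.map_strictMono_of_isInducing hind) Z
    have h2 := height_add_one_le_coheight b Z'
    let Q : PrimeSpectrum (MvPolynomial ι k) := ⟨_, hprime m hm⟩
    have hZ' : (Z' : Set (ℙ k V)) ⊆ S m := by
      refine closure_minimal ?_ hcl
      rintro _ ⟨p, -, rfl⟩
      exact p.2
    have h3 : Order.coheight (irreducibleClosedsPrime b Z') ≤ Order.coheight Q :=
      Order.coheight_anti (show Q ≤ irreducibleClosedsPrime b Z' from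
        projVanishingIdeal_anti b hZ')
    have h4 := le_height_of_chain b S hprime hlt hbot (N + 1 - m) m (by omega) Q rfl
    -- The total is bounded by the dimension of the polynomial ring. As the height of `Q` is at
    -- least N + 1 - m, its coheight is at most m + 1, which leaves at most m for the height of `Z`.
    have h5 : Order.height Q + Order.coheight Q ≤ ((N + 2 : ℕ) : ℕ∞) := by
      have h6 : ringKrullDim (MvPolynomial ι k) = ((N + 2 : ℕ) : ℕ∞) := by
        rw [MvPolynomial.ringKrullDim_of_isNoetherianRing, ringKrullDim_eq_zero_of_field, hN,
          zero_add]
        rfl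
      rw [ringKrullDim, Order.krullDim_eq_iSup_height_add_coheight_of_nonempty] at h6
      rw [← WithBot.coe_injective h6]
      exact le_iSup (fun a : PrimeSpectrum (MvPolynomial ι k) =>
        Order.height a + Order.coheight a) Q
    have h7 : ((N + 1 - m : ℕ) : ℕ∞) + (Order.height Z + 1) ≤ ((N + 2 : ℕ) : ℕ∞) :=
      le_trans (add_le_add h4 (le_trans (by gcongr) (h2.trans h3))) h5
    have h8 : Order.height Z ≤ (m : ℕ∞) := by
      cases hZ : Order.height Z with
      | top => rw [hZ] at h7; simp at h7
      | coe n =>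
        rw [hZ] at h7
        norm_cast at h7 ⊢
        omega
    exact_mod_cast h8
  -- The lower bound uses the closures of the sets `S i`; the strict drop of the ideals keeps them
  -- distinct.
  · have hirr : ∀ i ≤ m, IsIrreducible (closure (S i)) := fun i hi =>
      (isIrreducible_of_isPrime_projVanishingIdeal (hprime i (hi.trans hm))).closure
    have hsub : ∀ i ≤ m, closure (S i) ⊆ S m := fun i hi => closure_minimal (hmono hi) hcl
    let f : Fin (m + 1) → IrreducibleCloseds (S m) := fun i =>
      { carrier := Subtype.val ⁻¹' closure (S i)
        isIrreducible' := by
          refine ⟨?_, isPreirreducible_preimage_subtype_val (hsub i (by omega))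
            (hirr i (by omega)).2⟩
          obtain ⟨p, hp⟩ := (hirr i (by omega)).1
          exact ⟨⟨p, hsub i (by omega) hp⟩, hp⟩
        isClosed' := isClosed_closure.preimage continuous_subtype_val }
    have hf : StrictMono f := by
      rw [Fin.strictMono_iff_lt_succ]
      intro i
      refine lt_of_le_of_ne ?_ ?_
      · intro p hp
        exact closure_mono (hmono (Nat.le_succ i)) hp
      · intro h
        have hcc : closure (S (i + 1)) ⊆ closure (S i) := by
          intro p hp
          have hp' : (⟨p, hsub (i + 1) (by omega) hp⟩ : S m) ∈ f i.succ := hp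
          rw [← h] at hp'
          exact hp'
        refine absurd (hlt i (by omega)) (not_lt_of_ge ?_)
        rw [← projVanishingIdeal_closure b (S i), ← projVanishingIdeal_closure b (S (i + 1))]
        exact projVanishingIdeal_anti b hcc
    exact Order.le_krullDim_iff.2 ⟨LTSeries.mk m f hf, rfl⟩

end Dimension

/-! ### Normal form, rank and powers of bivectors -/

section Bivectors

variable {k W : Type*} [Field k] [AddCommGroup W] [Module k W]

open ExteriorAlgebra

/-- The decomposable bivector `a ∧ c`. -/
def wedge (a c : W) : ⋀[k]^2 W := exteriorPower.ιMulti k 2 ![a, c]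

lemma coe_wedge (a c : W) : (wedge a c : ⋀[k]^2 W) = (ι k a * ι k c : ExteriorAlgebra k W) := by
  simp [wedge, ExteriorAlgebra.ιMulti_apply]

lemma ι_mul_ι_swap (a c : W) : ι k a * ι k c = -(ι k c * ι k a) :=
  eq_neg_of_add_eq_zero_left (ι_add_mul_swap a c)

lemma wedge_add_left (a a' c : W) : (wedge (a + a') c : ⋀[k]^2 W) = wedge a c + wedge a' c :=
  Subtype.ext <| by simp [coe_wedge, add_mul]

lemma wedge_add_right (a c c' : W) : (wedge a (c + c') : ⋀[k]^2 W) = wedge a c + wedge a c' :=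
  Subtype.ext <| by simp [coe_wedge, mul_add]

lemma wedge_smul_left (t : k) (a c : W) : (wedge (t • a) c : ⋀[k]^2 W) = t • wedge a c :=
  Subtype.ext <| by simp [coe_wedge]

lemma wedge_smul_right (t : k) (a c : W) : (wedge a (t • c) : ⋀[k]^2 W) = t • wedge a c :=
  Subtype.ext <| by simp [coe_wedge]

lemma wedge_self (a : W) : (wedge a a : ⋀[k]^2 W) = 0 :=
  Subtype.ext <| by simp [coe_wedge]

lemma wedge_swap (a c : W) : (wedge a c : ⋀[k]^2 W) = -wedge c a :=
  Subtype.ext <| by simp only [NegMemClass.coe_neg, coe_wedge]; exact ι_mul_ι_swap a c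

lemma wedge_zero_left (c : W) : (wedge 0 c : ⋀[k]^2 W) = 0 :=
  Subtype.ext <| by simp [coe_wedge]

lemma wedge_zero_right (c : W) : (wedge c 0 : ⋀[k]^2 W) = 0 :=
  Subtype.ext <| by simp [coe_wedge]

lemma range_map_subtype_eq_span (U : Submodule k W) :
    LinearMap.range (exteriorPower.map 2 U.subtype) =
      Submodule.span k {φ : ⋀[k]^2 W | ∃ a ∈ U, ∃ c ∈ U, φ = wedge a c} := by
  rw [LinearMap.range_eq_map, ← exteriorPower.ιMulti_span, Submodule.map_span]
  congr 1
  ext φ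
  constructor
  · rintro ⟨_, ⟨v, rfl⟩, rfl⟩
    refine ⟨v 0, (v 0).2, v 1, (v 1).2, ?_⟩
    rw [exteriorPower.map_apply_ιMulti, wedge]
    congr 1
    ext i
    fin_cases i <;> rfl
  · rintro ⟨a, ha, c, hc, rfl⟩
    refine ⟨_, ⟨![⟨a, ha⟩, ⟨c, hc⟩], rfl⟩, ?_⟩
    rw [exteriorPower.map_apply_ιMulti, wedge]
    congr 1
    ext i
    fin_cases i <;> rfl

lemma wedge_mem_range_map {U : Submodule k W} {a c : W} (ha : a ∈ U) (hc : c ∈ U) :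
    wedge a c ∈ LinearMap.range (exteriorPower.map 2 U.subtype) := by
  rw [range_map_subtype_eq_span]
  exact Submodule.subset_span ⟨a, ha, c, hc, rfl⟩

lemma span_range_wedge :
    Submodule.span k {φ : ⋀[k]^2 W | ∃ a c, φ = wedge a c} = ⊤ := by
  have h := range_map_subtype_eq_span (⊤ : Submodule k W)
  have h' : LinearMap.range (exteriorPower.map 2 (⊤ : Submodule k W).subtype) = ⊤ :=
    LinearMap.range_eq_top.2 (exteriorPower.map_surjective fun w => ⟨⟨w, trivial⟩, rfl⟩)
  rw [← h', h]
  simp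

/-- `φ` is a sum of `r` decomposable bivectors. -/
def IsWedgeSum : ℕ → ⋀[k]^2 W → Prop
  | 0, φ => φ = 0
  | r + 1, φ => ∃ (a c : W) (ψ : ⋀[k]^2 W), IsWedgeSum r ψ ∧ φ = wedge a c + ψ

lemma IsWedgeSum.succ {r : ℕ} {φ : ⋀[k]^2 W} (h : IsWedgeSum r φ) : IsWedgeSum (r + 1) φ :=
  ⟨0, 0, φ, h, by simp [wedge_zero_left]⟩

lemma IsWedgeSum.mono {r s : ℕ} (hrs : r ≤ s) {φ : ⋀[k]^2 W} (h : IsWedgeSum r φ) :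
    IsWedgeSum s φ := by
  induction hrs with
  | refl => exact h
  | step _ ih => exact ih.succ

lemma isWedgeSum_one_iff {φ : ⋀[k]^2 W} : IsWedgeSum 1 φ ↔ ∃ a c, φ = wedge a c := by
  simp [IsWedgeSum]

lemma isWedgeSum_two_iff {φ : ⋀[k]^2 W} :
    IsWedgeSum 2 φ ↔ ∃ a b c d, φ = wedge a b + wedge c d := by
  constructor
  · rintro ⟨a, b, ψ, hψ, rfl⟩
    obtain ⟨c, d, rfl⟩ := isWedgeSum_one_iff.1 hψ
    exact ⟨a, b, c, d, rfl⟩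
  · rintro ⟨a, b, c, d, rfl⟩
    exact ⟨a, b, _, isWedgeSum_one_iff.2 ⟨c, d, rfl⟩, rfl⟩

lemma isWedgeSum_three_iff {φ : ⋀[k]^2 W} :
    IsWedgeSum 3 φ ↔ ∃ a b c d e f, φ = wedge a b + (wedge c d + wedge e f) := by
  constructor
  · rintro ⟨a, b, ψ, hψ, rfl⟩
    obtain ⟨c, d, e, f, rfl⟩ := isWedgeSum_two_iff.1 hψ
    exact ⟨a, b, c, d, e, f, rfl⟩
  · rintro ⟨a, b, c, d, e, f, rfl⟩
    exact ⟨a, b, _, isWedgeSum_two_iff.2 ⟨c, d, e, f, rfl⟩, rfl⟩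

/-- Expanding along e and collecting the terms that contain it splits φ; the e∧e term vanishes. -/
lemma exists_eq_wedge_add {U U' : Submodule k W} {e : W} (hU : U ≤ k ∙ e ⊔ U') {φ : ⋀[k]^2 W}
    (hφ : φ ∈ LinearMap.range (exteriorPower.map 2 U.subtype)) :
    ∃ w ∈ U', ∃ ψ ∈ LinearMap.range (exteriorPower.map 2 U'.subtype), φ = wedge e w + ψ := by
  rw [range_map_subtype_eq_span] at hφ
  induction hφ using Submodule.span_induction with
  | mem φ h =>
    obtain ⟨a, ha, c, hc, rfl⟩ := h
    obtain ⟨_, ha1, a', ha', rfl⟩ := Submodule.mem_sup.1 (hU ha)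
    obtain ⟨_, hc1, c', hc', rfl⟩ := Submodule.mem_sup.1 (hU hc)
    obtain ⟨s, rfl⟩ := Submodule.mem_span_singleton.1 ha1
    obtain ⟨t, rfl⟩ := Submodule.mem_span_singleton.1 hc1
    -- The part of (s e + a')∧(t e + c') containing e is e∧(s c' - t a').
    refine ⟨s • c' + (-t) • a', U'.add_mem (U'.smul_mem _ hc') (U'.smul_mem _ ha'), wedge a' c',
      wedge_mem_range_map ha' hc', ?_⟩
    simp only [wedge_add_left, wedge_add_right, wedge_smul_left, wedge_smul_right, wedge_self,
      wedge_swap a' e]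
    module
  | zero => exact ⟨0, zero_mem _, 0, zero_mem _, by simp [wedge_zero_right]⟩
  | add φ φ' _ _ h h' =>
    obtain ⟨w, hw, ψ, hψ, rfl⟩ := h
    obtain ⟨w', hw', ψ', hψ', rfl⟩ := h'
    exact ⟨w + w', add_mem hw hw', ψ + ψ', add_mem hψ hψ', by rw [wedge_add_right]; abel⟩
  | smul t φ _ h =>
    obtain ⟨w, hw, ψ, hψ, rfl⟩ := h
    exact ⟨t • w, U'.smul_mem _ hw, t • ψ, Submodule.smul_mem _ _ hψ, by
      rw [wedge_smul_right, smul_add]⟩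

lemma exists_le_span_singleton_sup {U : Submodule k W} [Module.Finite k U] {e : W} (he : e ∈ U)
    (he0 : e ≠ 0) : ∃ U' : Submodule k W, Module.Finite k U' ∧
      Module.finrank k U' + 1 = Module.finrank k U ∧ U ≤ k ∙ e ⊔ U' := by
  obtain ⟨Q, hQ⟩ := (k ∙ e).exists_isCompl
  have he' : k ∙ e ≤ U := (Submodule.span_singleton_le_iff_mem _ _).2 he
  have hsup : k ∙ e ⊔ Q ⊓ U = U := by
    rw [← sup_inf_assoc_of_le _ he', hQ.sup_eq_top, top_inf_eq]
  have hinf : k ∙ e ⊓ (Q ⊓ U) = ⊥ := by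
    rw [← inf_assoc, hQ.inf_eq_bot, bot_inf_eq]
  have : Module.Finite k ↥(Q ⊓ U) := Submodule.finiteDimensional_of_le inf_le_right
  refine ⟨Q ⊓ U, this, ?_, hsup.ge⟩
  have h := Submodule.finrank_sup_add_finrank_inf_eq (k ∙ e) (Q ⊓ U)
  rw [hsup, hinf, finrank_bot, finrank_span_singleton he0] at h
  omega

/-- The normal form of bivectors. -/
lemma isWedgeSum_of_finrank_eq {n : ℕ} : ∀ {U : Submodule k W} [Module.Finite k U]
    (_ : Module.finrank k U = n) {φ : ⋀[k]^2 W}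
    (_ : φ ∈ LinearMap.range (exteriorPower.map 2 U.subtype)), IsWedgeSum (n / 2) φ := by
  induction n using Nat.strong_induction_on with
  | h n ih =>
  intro U _ hU φ hφ
  rcases n with _ | m
  · rw [Submodule.finrank_eq_zero] at hU
    subst hU
    rw [range_map_subtype_eq_span] at hφ
    have : {φ : ⋀[k]^2 W | ∃ a ∈ (⊥ : Submodule k W), ∃ c ∈ (⊥ : Submodule k W),
        φ = wedge a c} ⊆ {0} := by
      rintro _ ⟨a, ha, c, -, rfl⟩
      rw [(Submodule.mem_bot k).1 ha, wedge_zero_left]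
      rfl
    simpa [IsWedgeSum] using Submodule.span_mono this hφ
  · obtain ⟨e, he, he0⟩ := (Submodule.ne_bot_iff U).1 (by
      rintro rfl
      simp at hU)
    obtain ⟨U', _, hU', hle⟩ := exists_le_span_singleton_sup he he0
    obtain ⟨w, hw, ψ, hψ, rfl⟩ := exists_eq_wedge_add hle hφ
    by_cases hw0 : w = 0
    · subst hw0
      rw [wedge_zero_right, zero_add]
      exact (ih m (by omega) (by omega) hψ).mono (by omega)
    · obtain ⟨U'', _, hU'', hle'⟩ := exists_le_span_singleton_sup hw hw0
      obtain ⟨w', hw', ψ', hψ', rfl⟩ := exists_eq_wedge_add hle' hψ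
      have h := ih (m - 1) (by omega) (by omega) hψ'
      have h2 : IsWedgeSum ((m - 1) / 2 + 1) (wedge e w + (wedge w w' + ψ')) := by
        -- e∧w + w∧w' = (e - w')∧w: two dimensions are used up by one decomposable summand.
        refine ⟨e + (-1 : k) • w', w, ψ', h, ?_⟩
        rw [wedge_add_left, wedge_smul_left, wedge_swap w' w]
        module
      exact h2.mono (by omega)

lemma isWedgeSum_of_finrank_le {n : ℕ} {U : Submodule k W} [Module.Finite k U]
    (hU : Module.finrank k U ≤ n) {φ : ⋀[k]^2 W}
    (hφ : φ ∈ LinearMap.range (exteriorPower.map 2 U.subtype)) : IsWedgeSum (n / 2) φ :=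
  (isWedgeSum_of_finrank_eq rfl hφ).mono (Nat.div_le_div_right hU)

lemma ιMulti_ne_zero {n : ℕ} {v : Fin n → W} (hv : LinearIndependent k v) :
    ExteriorAlgebra.ιMulti k n v ≠ 0 := by
  have h := (exteriorPower.ιMulti_family_linearIndependent_field n hv).ne_zero
    (Set.powersetCard.ofFinEmbEquiv (RelEmbedding.refl _))
  intro h0
  apply h
  apply Subtype.ext
  simpa [exteriorPower.ιMulti_family] using h0

/-- The span has dimension at most n. This is applied with n = 5 and n = 3, where rounding n/2 down
saves a whole summand. -/
lemma isWedgeSum_of_not_linearIndependent {n : ℕ} {v : Fin (n + 1) → W}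
    (hv : ¬ LinearIndependent k v) {φ : ⋀[k]^2 W}
    (hφ : φ ∈ LinearMap.range (exteriorPower.map 2 (Submodule.span k (Set.range v)).subtype)) :
    IsWedgeSum (n / 2) φ := by
  have := FiniteDimensional.span_of_finite k (Set.finite_range v)
  refine isWedgeSum_of_finrank_le ?_ hφ
  have h1 := finrank_range_le_card (R := k) v
  rw [Fintype.card_fin] at h1
  by_contra hcon
  apply hv
  rw [linearIndependent_iff_card_eq_finrank_span, Fintype.card_fin]
  simp only [Set.finrank] at h1 ⊢
  omega

lemma ι_mul_ι_commute (a b c : W) : Commute (ι k a * ι k b) (ι k c) := by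
  have h1 : ι k b * ι k c = -(ι k c * ι k b) := ι_mul_ι_swap b c
  have h2 : ι k a * ι k c = -(ι k c * ι k a) := ι_mul_ι_swap a c
  rw [Commute, SemiconjBy, mul_assoc, h1, mul_neg, ← mul_assoc, h2, neg_mul, neg_neg, mul_assoc]

lemma ι_mul_ι_commute' (a b c d : W) : Commute (ι k a * ι k b) (ι k c * ι k d) :=
  (ι_mul_ι_commute a b c).mul_right (ι_mul_ι_commute a b d)

lemma ι_mul_ι_sq (a b : W) : (ι k a * ι k b) * (ι k a * ι k b) = 0 := by
  rw [← mul_assoc, (ι_mul_ι_commute a b a).eq, ← mul_assoc, ι_sq_zero, zero_mul, zero_mul]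

lemma add_sq_of_commute {A : Type*} [Ring A] {P Q : A} (h : Commute P Q) (hP : P * P = 0)
    (hQ : Q * Q = 0) : (P + Q) ^ 2 = 2 * (P * Q) := by
  rw [h.add_sq, sq, sq, hP, hQ, zero_add, add_zero, mul_assoc]

lemma add_cube_of_commute {A : Type*} [Ring A] {P Q : A} (h : Commute P Q) (hP : P * P = 0)
    (hQ : Q * Q = 0) : (P + Q) ^ 3 = 0 := by
  rw [pow_succ, add_sq_of_commute h hP hQ, mul_assoc, mul_add, mul_assoc, mul_assoc, hQ,
    ← h.eq, ← mul_assoc P, hP]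
  simp

/-- With commuting elements of square zero, only the product PQR survives in the expansion, with
multinomial coefficient 3! = 6. -/
lemma add_add_cube_of_commute {A : Type*} [Ring A] {P Q R : A} (hPQ : Commute P Q)
    (hPR : Commute P R) (hQR : Commute Q R) (hP : P * P = 0) (hQ : Q * Q = 0) (hR : R * R = 0) :
    (P + (Q + R)) ^ 3 = 6 * (P * (Q * R)) := by
  have h : Commute P (Q + R) := hPQ.add_right hPR
  have h3 := add_cube_of_commute hQR hQ hR
  have h2 := add_sq_of_commute hQR hQ hR
  have e : (P + (Q + R)) ^ 3 = P * P * P + 3 * (P * P * (Q + R)) + 3 * (P * (Q + R) ^ 2)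
      + (Q + R) ^ 3 := by
    generalize Q + R = S at h
    have := h.eq
    rw [pow_succ, h.add_sq, add_mul, add_mul, mul_add, mul_add, mul_add]
    have e1 : S ^ 2 * P = P * S ^ 2 := (h.symm.pow_left 2).eq
    have e2 : 2 * P * S * P = 2 * (P * P * S) := by
      rw [mul_assoc (2 * P), ← this]; noncomm_ring
    rw [e1, e2]
    noncomm_ring
  rw [e, h3, h2, hP]
  have : (6 : A) = 3 * 2 := by norm_num
  rw [this]
  simp only [zero_mul, mul_zero, zero_add, add_zero]
  noncomm_ring

section Powers

variable (a b c d e f : W)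

lemma coe_wedge_pow_two : ((wedge a b : ⋀[k]^2 W) : ExteriorAlgebra k W) ^ 2 = 0 := by
  rw [coe_wedge, sq, ι_mul_ι_sq]

lemma coe_wedge_add_wedge_pow_two :
    ((wedge a b + wedge c d : ⋀[k]^2 W) : ExteriorAlgebra k W) ^ 2 =
      2 * ExteriorAlgebra.ιMulti k 4 ![a, b, c, d] := by
  rw [Submodule.coe_add, coe_wedge, coe_wedge,
    add_sq_of_commute (ι_mul_ι_commute' a b c d) (ι_mul_ι_sq a b) (ι_mul_ι_sq c d)]
  simp [ExteriorAlgebra.ιMulti_apply, mul_assoc]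

lemma coe_wedge_add_wedge_pow_three :
    ((wedge a b + wedge c d : ⋀[k]^2 W) : ExteriorAlgebra k W) ^ 3 = 0 := by
  rw [Submodule.coe_add, coe_wedge, coe_wedge,
    add_cube_of_commute (ι_mul_ι_commute' a b c d) (ι_mul_ι_sq a b) (ι_mul_ι_sq c d)]

lemma coe_wedge_add_wedge_add_wedge_pow_three :
    ((wedge a b + (wedge c d + wedge e f) : ⋀[k]^2 W) : ExteriorAlgebra k W) ^ 3 =
      6 * ExteriorAlgebra.ιMulti k 6 ![a, b, c, d, e, f] := by
  rw [Submodule.coe_add, Submodule.coe_add, coe_wedge, coe_wedge, coe_wedge,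
    add_add_cube_of_commute (ι_mul_ι_commute' a b c d) (ι_mul_ι_commute' a b e f)
      (ι_mul_ι_commute' c d e f) (ι_mul_ι_sq a b) (ι_mul_ι_sq c d) (ι_mul_ι_sq e f)]
  simp [ExteriorAlgebra.ιMulti_apply, mul_assoc]

end Powers

lemma ofNat_mul_eq_zero_iff [CharZero k] {n : ℕ} (hn : n ≠ 0) {y : ExteriorAlgebra k W} :
    (n : ExteriorAlgebra k W) * y = 0 ↔ y = 0 := by
  rw [← nsmul_eq_mul, ← Nat.cast_smul_eq_nsmul k, smul_eq_zero_iff_right (Nat.cast_ne_zero.2 hn)]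

lemma mem_range_map_top (φ : ⋀[k]^2 W) :
    φ ∈ LinearMap.range (exteriorPower.map 2 (⊤ : Submodule k W).subtype) := by
  have h : LinearMap.range (exteriorPower.map 2 (⊤ : Submodule k W).subtype) = ⊤ :=
    LinearMap.range_eq_top.2 (exteriorPower.map_surjective fun w => ⟨⟨w, trivial⟩, rfl⟩)
  rw [h]
  trivial

lemma isWedgeSum_two_of_pow_three_eq_zero [CharZero k] (hW : Module.finrank k W = 6)
    {φ : ⋀[k]^2 W} (h : (φ : ExteriorAlgebra k W) ^ 3 = 0) : IsWedgeSum 2 φ := by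
  have : Module.Finite k W := Module.finite_of_finrank_pos (by omega)
  have h3 : IsWedgeSum 3 φ :=
    isWedgeSum_of_finrank_le (n := 6) (by rw [finrank_top, hW]) (mem_range_map_top φ)
  obtain ⟨a, b, c, d, e, f, rfl⟩ := isWedgeSum_three_iff.1 h3
  rw [coe_wedge_add_wedge_add_wedge_pow_three] at h
  refine isWedgeSum_of_not_linearIndependent (n := 5) (v := ![a, b, c, d, e, f])
    (fun hv => ιMulti_ne_zero hv ((ofNat_mul_eq_zero_iff (n := 6) (by norm_num)).1 h)) ?_
  have hmem : ∀ i, ![a, b, c, d, e, f] i ∈ Submodule.span k (Set.range ![a, b, c, d, e, f]) :=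
    fun i => Submodule.subset_span ⟨i, rfl⟩
  exact add_mem (wedge_mem_range_map (hmem 0) (hmem 1))
    (add_mem (wedge_mem_range_map (hmem 2) (hmem 3)) (wedge_mem_range_map (hmem 4) (hmem 5)))

lemma pow_three_eq_zero_iff [CharZero k] (hW : Module.finrank k W = 6) {φ : ⋀[k]^2 W} :
    (φ : ExteriorAlgebra k W) ^ 3 = 0 ↔ IsWedgeSum 2 φ := by
  refine ⟨isWedgeSum_two_of_pow_three_eq_zero hW, fun h => ?_⟩
  obtain ⟨a, b, c, d, rfl⟩ := isWedgeSum_two_iff.1 h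
  exact coe_wedge_add_wedge_pow_three a b c d

lemma pow_two_eq_zero_iff_isWedgeSum [CharZero k] (hW : Module.finrank k W = 6) {φ : ⋀[k]^2 W} :
    (φ : ExteriorAlgebra k W) ^ 2 = 0 ↔ IsWedgeSum 1 φ := by
  constructor
  · intro h
    -- φ² = 0 implies φ³ = 0, so two summands are available from the cubic case.
    obtain ⟨a, b, c, d, rfl⟩ := isWedgeSum_two_iff.1
      (isWedgeSum_two_of_pow_three_eq_zero hW (by rw [pow_succ, h, zero_mul]))
    rw [coe_wedge_add_wedge_pow_two] at h
    refine isWedgeSum_of_not_linearIndependent (n := 3) (v := ![a, b, c, d])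
      (fun hv => ιMulti_ne_zero hv ((ofNat_mul_eq_zero_iff (n := 2) (by norm_num)).1 h)) ?_
    have hmem : ∀ i, ![a, b, c, d] i ∈ Submodule.span k (Set.range ![a, b, c, d]) :=
      fun i => Submodule.subset_span ⟨i, rfl⟩
    exact add_mem (wedge_mem_range_map (hmem 0) (hmem 1)) (wedge_mem_range_map (hmem 2) (hmem 3))
  · intro h
    obtain ⟨a, b, rfl⟩ := isWedgeSum_one_iff.1 h
    exact coe_wedge_pow_two a b

lemma IsWedgeSum.exists_mem_range {r : ℕ} {φ : ⋀[k]^2 W} (h : IsWedgeSum r φ) :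
    ∃ U : Submodule k W, Module.Finite k U ∧ Module.finrank k U ≤ 2 * r ∧
      φ ∈ LinearMap.range (exteriorPower.map 2 U.subtype) := by
  induction r generalizing φ with
  | zero =>
    obtain rfl : φ = 0 := h
    exact ⟨⊥, inferInstance, by simp, zero_mem _⟩
  | succ r ih =>
    obtain ⟨a, c, ψ, hψ, rfl⟩ := h
    obtain ⟨U, _, hU, hψU⟩ := ih hψ
    have := FiniteDimensional.span_of_finite k (Set.finite_range ![a, c])
    refine ⟨Submodule.span k (Set.range ![a, c]) ⊔ U, inferInstance, ?_, ?_⟩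
    · have h1 := finrank_range_le_card (R := k) ![a, c]
      have h2 := Submodule.finrank_add_le_finrank_add_finrank
        (Submodule.span k (Set.range ![a, c])) U
      simp only [Set.finrank, Fintype.card_fin] at h1
      omega
    · have hmem : ∀ i, ![a, c] i ∈ Submodule.span k (Set.range ![a, c]) ⊔ U :=
        fun i => Submodule.mem_sup_left (Submodule.subset_span ⟨i, rfl⟩)
      refine add_mem (wedge_mem_range_map (hmem 0) (hmem 1)) ?_
      rw [range_map_subtype_eq_span] at hψU ⊢
      refine Submodule.span_mono ?_ hψU
      rintro _ ⟨a, ha, c, hc, rfl⟩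
      exact ⟨a, Submodule.mem_sup_right ha, c, Submodule.mem_sup_right hc, rfl⟩

/-- Finite dimension makes the infimum range over a nonempty set, so it is attained. Rounding n/2
down reflects that ranks are even. -/
lemma bivectorRank_le_iff [Module.Finite k W] {n : ℕ} {φ : ⋀[k]^2 W} :
    bivectorRank φ ≤ n ↔ IsWedgeSum (n / 2) φ := by
  constructor
  · intro h
    obtain ⟨U, _, hU, hφ⟩ := Nat.sInf_mem (s := {n | ∃ U : Submodule k W, Module.Finite k U ∧
      Module.finrank k U = n ∧ φ ∈ LinearMap.range (exteriorPower.map 2 U.subtype)})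
      ⟨_, ⊤, inferInstance, rfl, mem_range_map_top φ⟩
    exact isWedgeSum_of_finrank_le (hU.trans_le h) hφ
  · intro h
    obtain ⟨U, hfin, hU, hφ⟩ := h.exists_mem_range
    have h1 : bivectorRank φ ≤ Module.finrank k U := Nat.sInf_le ⟨U, hfin, rfl, hφ⟩
    omega

lemma bivectorRank_eq_two_iff [Module.Finite k W] {φ : ⋀[k]^2 W} (hφ : φ ≠ 0) :
    bivectorRank φ = 2 ↔ IsWedgeSum 1 φ := by
  -- Here 1 / 2 = 0, and an empty sum of wedges is zero.
  have h1 : ¬ bivectorRank φ ≤ 1 := fun h => hφ (bivectorRank_le_iff.1 h)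
  rw [← show 2 / 2 = 1 from rfl, ← bivectorRank_le_iff]
  omega

lemma mem_lineGrassmannian_iff {p : ℙ k (⋀[k]^2 W)} :
    p ∈ lineGrassmannian k W ↔ IsWedgeSum 1 p.rep := by
  constructor
  · rintro ⟨U, hU, hp⟩
    have : Module.Finite k U := Module.finite_of_finrank_pos (by omega)
    refine isWedgeSum_of_finrank_le (n := 2) hU.le (hp ▸ ?_)
    rw [Projectivization.submodule_eq]
    exact Submodule.mem_span_singleton_self _
  · intro h
    obtain ⟨a, c, hac⟩ := isWedgeSum_one_iff.1 h
    have hli : LinearIndependent k ![a, c] := by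
      by_contra hli
      have := AlternatingMap.map_linearDependent (exteriorPower.ιMulti k 2) _ hli
      exact p.rep_nonzero (hac.trans this)
    have := FiniteDimensional.span_of_finite k (Set.finite_range ![a, c])
    have hU : Module.finrank k (Submodule.span k (Set.range ![a, c])) = 2 := by
      rw [finrank_span_eq_card hli, Fintype.card_fin]
    refine ⟨Submodule.span k (Set.range ![a, c]), hU, ?_⟩
    have hmem : ∀ i, ![a, c] i ∈ Submodule.span k (Set.range ![a, c]) :=
        fun i => Submodule.subset_span ⟨i, rfl⟩
    have hle : p.submodule ≤ LinearMap.range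
        (exteriorPower.map 2 (Submodule.span k (Set.range ![a, c])).subtype) := by
      rw [Projectivization.submodule_eq, Submodule.span_singleton_le_iff_mem, hac]
      exact wedge_mem_range_map (hmem 0) (hmem 1)
    refine Submodule.eq_of_le_of_finrank_le hle ?_
    refine (LinearMap.finrank_range_le _).trans ?_
    rw [exteriorPower.finrank_eq, hU, p.finrank_submodule]
    rfl

end Bivectors

/-! ### Plücker coordinates, the chain of cones and the Pfaffian -/

section PluckerCoordinates

variable {k W : Type*} [Field k] [AddCommGroup W] [Module k W]

open MvPolynomial

/-- For a functional `ℓ` on the exterior algebra, `φ ↦ ℓ (φ ^ n)` is a form of degree `n` in the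
coordinates of the bivector `φ`. -/
lemma exists_isHomogeneous_eval_eq_pow {ι : Type*} [Fintype ι] (B : Module.Basis ι k (⋀[k]^2 W))
    (n : ℕ) (ℓ : ExteriorAlgebra k W →ₗ[k] k) :
    ∃ F : MvPolynomial ι k, F.IsHomogeneous n ∧
      ∀ φ : ⋀[k]^2 W, eval (B.repr φ) F = ℓ ((φ : ExteriorAlgebra k W) ^ n) := by
  induction n generalizing ℓ with
  | zero => exact ⟨C (ℓ 1), isHomogeneous_C _ _, fun φ => by simp⟩
  | succ n ih =>
    choose F hF hFe using fun i : ι =>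
      ih (ℓ ∘ₗ LinearMap.mulLeft k (B i : ExteriorAlgebra k W))
    refine ⟨∑ i, F i * X i, IsHomogeneous.sum _ _ _ fun i _ => (hF i).mul (isHomogeneous_X _ _),
      fun φ => ?_⟩
    have hφ : (φ : ExteriorAlgebra k W) = ∑ i, B.repr φ i • (B i : ExteriorAlgebra k W) := by
      refine (congrArg (⋀[k]^2 W).subtype (B.sum_repr φ)).symm.trans ?_
      simp only [map_sum, map_smul]
      rfl
    have hφn : (φ : ExteriorAlgebra k W) ^ (n + 1) =
        (∑ i, B.repr φ i • (B i : ExteriorAlgebra k W)) * (φ : ExteriorAlgebra k W) ^ n := by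
      rw [← hφ, pow_succ']
    rw [hφn, map_sum, Finset.sum_mul, map_sum]
    refine Finset.sum_congr rfl fun i _ => ?_
    simp [hFe, mul_comm]

/-- The equation takes values in the exterior algebra; testing it against every functional turns it
into scalar forms of degree n. -/
lemma isClosed_pow_eq_zero {ι : Type*} [Fintype ι] (B : Module.Basis ι k (⋀[k]^2 W)) (n : ℕ) :
    @IsClosed _ (projZariskiTopology B)
      {p : ℙ k (⋀[k]^2 W) | (p.rep : ExteriorAlgebra k W) ^ n = 0} := by
  let := projZariskiTopology B
  choose F hF hFe using exists_isHomogeneous_eval_eq_pow B n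
  have h : {p : ℙ k (⋀[k]^2 W) | (p.rep : ExteriorAlgebra k W) ^ n = 0} =
      ⋂ ℓ, projZeroLocus B (F ℓ) := by
    ext p
    simp only [projZeroLocus, Set.mem_iInter, Set.mem_ofPred_eq, hFe]
    exact (Module.forall_dual_apply_eq_zero_iff k _).symm
  rw [h]
  exact isClosed_iInter fun ℓ => isClosed_projZeroLocus B (hF ℓ)

/-- The smaller element of a two-element subset. -/
def pairFst (P : Set.powersetCard (Fin 6) 2) : Fin 6 := Set.powersetCard.ofFinEmbEquiv.symm P 0

/-- The larger element of a two-element subset. -/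
def pairSnd (P : Set.powersetCard (Fin 6) 2) : Fin 6 := Set.powersetCard.ofFinEmbEquiv.symm P 1

/-- The two-element subset `{i, j}`. -/
def pairMk (i j : Fin 6) (h : i < j) : Set.powersetCard (Fin 6) 2 :=
  Set.powersetCard.ofFinEmbEquiv (OrderEmbedding.ofStrictMono ![i, j] (by
    rw [Fin.strictMono_iff_lt_succ]
    intro l
    fin_cases l
    exact h))

lemma pairFst_pairMk {i j : Fin 6} (h : i < j) : pairFst (pairMk i j h) = i := by
  simp [pairFst, pairMk]

lemma pairSnd_pairMk {i j : Fin 6} (h : i < j) : pairSnd (pairMk i j h) = j := by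
  simp [pairSnd, pairMk]

lemma pairFst_lt_pairSnd (P : Set.powersetCard (Fin 6) 2) : pairFst P < pairSnd P :=
  (Set.powersetCard.ofFinEmbEquiv.symm P).strictMono (by decide)

variable (x : Module.Basis (Fin 6) k W)

lemma exteriorPower_repr_wedge (a c : W) (P : Set.powersetCard (Fin 6) 2) :
    (x.exteriorPower 2).repr (wedge a c) P =
      x.repr a (pairFst P) * x.repr c (pairSnd P) - x.repr a (pairSnd P) * x.repr c (pairFst P) := by
  rw [exteriorPower.basis_repr_apply, wedge, exteriorPower.ιMultiDual_apply_ιMulti,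
    Matrix.det_fin_two]
  simp [pairFst, pairSnd]

lemma exteriorPower_basis_eq_wedge (P : Set.powersetCard (Fin 6) 2) :
    x.exteriorPower 2 P = wedge (x (pairFst P)) (x (pairSnd P)) := by
  rw [exteriorPower.basis_apply, exteriorPower.ιMulti_family, wedge]
  congr 1
  ext i
  fin_cases i <;> rfl

/-- The bivectors `a ∧ b + c ∧ d` with `a`, `b`, `c`, `d` in the members of the coordinate flag
of dimensions `s 0`, `s 1`, `s 2`, `s 3`. -/
def bivectorCone (s : Fin 4 → ℕ) : Set (⋀[k]^2 W) :=
  {φ | ∃ v : Fin 4 → W, (∀ r, ∀ j : Fin 6, s r ≤ j → x.repr (v r) j = 0) ∧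
    φ = wedge (v 0) (v 1) + wedge (v 2) (v 3)}

lemma isCone_bivectorCone (s : Fin 4 → ℕ) : IsCone k (bivectorCone x s) := by
  rintro t _ ⟨v, hv, rfl⟩
  refine ⟨![t • v 0, v 1, t • v 2, v 3], ?_, ?_⟩
  · intro r j hj
    have := hv r j hj
    fin_cases r <;> simp_all
  · simp [wedge_smul_left]

lemma bivectorCone_mono {s s' : Fin 4 → ℕ} (h : s ≤ s') : bivectorCone x s ⊆ bivectorCone x s' := by
  rintro _ ⟨v, hv, rfl⟩
  exact ⟨v, fun r j hj => hv r j ((h r).trans hj), rfl⟩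

lemma wedge_basis_mem_bivectorCone {s : Fin 4 → ℕ} {i j : Fin 6} (hi : i < s 0) (hj : j < s 1) :
    wedge (x i) (x j) ∈ bivectorCone x s := by
  refine ⟨![x i, x j, 0, 0], ?_, by simp [wedge_zero_left]⟩
  intro r l hl
  fin_cases r
  · simpa [Finsupp.single_apply] using (by rintro rfl; simp at hl; omega)
  · simpa [Finsupp.single_apply] using (by rintro rfl; simp at hl; omega)
  · simp
  · simp

lemma wedge_add_wedge_basis_mem_bivectorCone {s : Fin 4 → ℕ} {e : Fin 4 → Fin 6}
    (he : ∀ r, e r < s r) :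
    wedge (x (e 0)) (x (e 1)) + wedge (x (e 2)) (x (e 3)) ∈ bivectorCone x s := by
  refine ⟨fun r => x (e r), ?_, rfl⟩
  intro r l hl
  have := he r
  simpa [Finsupp.single_apply] using (by rintro rfl; omega)

lemma exists_ne_zero_mem_bivectorCone {s : Fin 4 → ℕ} (h0 : 1 ≤ s 0) (h1 : 2 ≤ s 1) :
    ∃ φ ∈ bivectorCone x s, φ ≠ 0 := by
  refine ⟨_, wedge_basis_mem_bivectorCone x (i := 0) (j := 1) h0 h1, ?_⟩
  have := (x.exteriorPower 2).ne_zero (pairMk 0 1 (by decide))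
  rwa [exteriorPower_basis_eq_wedge, pairFst_pairMk, pairSnd_pairMk] at this

/-- The coordinates of the four vectors are either free variables or zero, as recorded by `α`, so
the cone is the image of a polynomial map and its ideal is the kernel of a map into a domain. -/
lemma isPrime_projVanishingIdeal_bivectorCone [Infinite k] {s : Fin 4 → ℕ} (h0 : 1 ≤ s 0)
    (h1 : 2 ≤ s 1) :
    (projVanishingIdeal (x.exteriorPower 2) (coneLocus (bivectorCone x s))).IsPrime := by
  let α : Fin 4 → Fin 6 → MvPolynomial (Fin 4 × Fin 6) k :=
    fun r j => if s r ≤ j then 0 else X (r, j)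
  let g : Set.powersetCard (Fin 6) 2 → MvPolynomial (Fin 4 × Fin 6) k := fun P =>
    α 0 (pairFst P) * α 1 (pairSnd P) - α 0 (pairSnd P) * α 1 (pairFst P) +
      (α 2 (pairFst P) * α 3 (pairSnd P) - α 2 (pairSnd P) * α 3 (pairFst P))
  have key : ∀ (v : Fin 4 → W) (y : Fin 4 × Fin 6 → k),
      (∀ r j, x.repr (v r) j = eval y (α r j)) → ∀ P,
      (x.exteriorPower 2).repr (wedge (v 0) (v 1) + wedge (v 2) (v 3)) P = eval y (g P) := by
    intro v y h P
    simp only [map_add, Finsupp.add_apply, exteriorPower_repr_wedge, h, g, map_sub, map_mul]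
  rw [projVanishingIdeal_coneLocus_eq_ker (isCone_bivectorCone x s)
    (exists_ne_zero_mem_bivectorCone x h0 h1) g]
  · exact RingHom.ker_isPrime _
  · rintro _ ⟨v, hv, rfl⟩
    refine ⟨fun p => x.repr (v p.1) p.2, key v (fun p => x.repr (v p.1) p.2) fun r j => ?_⟩
    by_cases h : s r ≤ j
    · simp [α, h, hv r j h]
    · simp [α, h]
  · intro y
    refine ⟨_, ⟨fun r => ∑ j, eval y (α r j) • x j, ?_, rfl⟩,
      key (fun r => ∑ j, eval y (α r j) • x j) y fun r j => ?_⟩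
    · intro r j hj
      rw [x.repr_sum_self]
      simp [α, hj]
    · rw [x.repr_sum_self]

lemma projVanishingIdeal_coneLocus_lt [Infinite k] {ι V : Type*} [AddCommGroup V] [Module k V]
    (B : Module.Basis ι k V) {T T' : Set V} (hT : IsCone k T) (hT' : IsCone k T') (hTT' : T ⊆ T')
    (hne : ∃ v ∈ T, v ≠ 0) (F : MvPolynomial ι k) (hF : ∀ v ∈ T, eval (B.repr v) F = 0)
    (hF' : ∃ v ∈ T', eval (B.repr v) F ≠ 0) :
    projVanishingIdeal B (coneLocus T') < projVanishingIdeal B (coneLocus T) := by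
  refine lt_of_le_of_ne (projVanishingIdeal_anti B fun p hp => hTT' hp) fun h => ?_
  obtain ⟨v, hv, hvF⟩ := hF'
  have h1 := (mem_projVanishingIdeal_coneLocus (b := B) hT hne).2 hF
  rw [← h, mem_projVanishingIdeal_coneLocus hT' (hne.imp fun v hv => ⟨hTT' hv.1, hv.2⟩)] at h1
  exact hvF (h1 v hv)

/-- The separating polynomial is the Plücker coordinate of {i, j}. On the smaller cone both terms of
the minor vanish, and `s 2 = 0` removes the second wedge. -/
lemma projVanishingIdeal_bivectorCone_lt_of_pair [Infinite k] {s s' : Fin 4 → ℕ} (hss' : s ≤ s')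
    (h0 : 1 ≤ s 0) (h1 : 2 ≤ s 1) (h2 : s 2 = 0) {i j : Fin 6} (hij : i < j)
    (h : s 0 ≤ i ∨ s 1 ≤ j) (h' : s 0 ≤ j ∨ s 1 ≤ i) (hi : i < s' 0) (hj : j < s' 1) :
    projVanishingIdeal (x.exteriorPower 2) (coneLocus (bivectorCone x s')) <
      projVanishingIdeal (x.exteriorPower 2) (coneLocus (bivectorCone x s)) := by
  refine projVanishingIdeal_coneLocus_lt _ (isCone_bivectorCone x s) (isCone_bivectorCone x s')
    (bivectorCone_mono x hss') (exists_ne_zero_mem_bivectorCone x h0 h1) (X (pairMk i j hij)) ?_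
    ⟨_, wedge_basis_mem_bivectorCone x hi hj, ?_⟩
  · rintro _ ⟨v, hv, rfl⟩
    rw [eval_X, map_add, Finsupp.add_apply, exteriorPower_repr_wedge, exteriorPower_repr_wedge,
      pairFst_pairMk, pairSnd_pairMk, hv 2 i (by omega), hv 2 j (by omega)]
    have e1 : x.repr (v 0) i * x.repr (v 1) j = 0 := by
      rcases h with h | h
      · rw [hv 0 i h, zero_mul]
      · rw [hv 1 j h, mul_zero]
    have e2 : x.repr (v 0) j * x.repr (v 1) i = 0 := by
      rcases h' with h | h
      · rw [hv 0 j h, zero_mul]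
      · rw [hv 1 i h, mul_zero]
    rw [e1, e2]
    ring
  · rw [eval_X, exteriorPower_repr_wedge, pairFst_pairMk, pairSnd_pairMk]
    simp [hij.ne, hij.ne']

lemma ιMulti_four_mul (a b c d e f : W) :
    ExteriorAlgebra.ιMulti k 4 ![a, b, c, d] *
      (ExteriorAlgebra.ι k e * ExteriorAlgebra.ι k f) =
      ExteriorAlgebra.ιMulti k 6 ![a, b, c, d, e, f] := by
  simp [ExteriorAlgebra.ιMulti_apply, mul_assoc]

/-- The separating polynomial is the quadric φ ↦ ℓ(φ² ∧ x_{e 4} ∧ x_{e 5}). At v 0∧v 1 + v 2∧v 3 it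
is twice ℓ of a wedge of six vectors: zero when these are dependent, nonzero for the permuted basis
vectors. -/
lemma projVanishingIdeal_bivectorCone_lt_of_quadric [CharZero k] {s s' : Fin 4 → ℕ} (hss' : s ≤ s')
    (h0 : 1 ≤ s 0) (h1 : 2 ≤ s 1) (e : Fin 6 → Fin 6) (he : Function.Injective e)
    (hs : ∀ v : Fin 4 → W, (∀ r, ∀ j : Fin 6, s r ≤ j → x.repr (v r) j = 0) →
      ¬ LinearIndependent k ![v 0, v 1, v 2, v 3, x (e 4), x (e 5)])
    (hs' : ∀ r : Fin 4, e (r.castLE (by decide)) < s' r) :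
    projVanishingIdeal (x.exteriorPower 2) (coneLocus (bivectorCone x s')) <
      projVanishingIdeal (x.exteriorPower 2) (coneLocus (bivectorCone x s)) := by
  have hτ : ExteriorAlgebra.ιMulti k 6 ![x (e 0), x (e 1), x (e 2), x (e 3), x (e 4), x (e 5)] ≠
      0 := by
    refine ιMulti_ne_zero ?_
    convert x.linearIndependent.comp e he using 1
    ext i
    fin_cases i <;> rfl
  have hτ' : ∃ ℓ : Module.Dual k (ExteriorAlgebra k W), ℓ (ExteriorAlgebra.ιMulti k 6
      ![x (e 0), x (e 1), x (e 2), x (e 3), x (e 4), x (e 5)]) ≠ 0 := by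
    by_contra! h
    exact hτ ((Module.forall_dual_apply_eq_zero_iff k _).1 h)
  obtain ⟨ℓ, hℓ⟩ := hτ'
  obtain ⟨F, -, hF⟩ := exists_isHomogeneous_eval_eq_pow (x.exteriorPower 2) 2 (ℓ ∘ₗ
    LinearMap.mulRight k (ExteriorAlgebra.ι k (x (e 4)) * ExteriorAlgebra.ι k (x (e 5))))
  have hF' : ∀ a b c d, eval ((x.exteriorPower 2).repr (wedge a b + wedge c d)) F =
      2 * ℓ (ExteriorAlgebra.ιMulti k 6 ![a, b, c, d, x (e 4), x (e 5)]) := by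
    intro a b c d
    rw [hF, LinearMap.comp_apply, LinearMap.mulRight_apply, coe_wedge_add_wedge_pow_two, mul_assoc,
      ιMulti_four_mul, two_mul, map_add, two_mul]
  refine projVanishingIdeal_coneLocus_lt _ (isCone_bivectorCone x s) (isCone_bivectorCone x s')
    (bivectorCone_mono x hss') (exists_ne_zero_mem_bivectorCone x h0 h1) F ?_
    ⟨_, wedge_add_wedge_basis_mem_bivectorCone x hs', ?_⟩
  · rintro _ ⟨v, hv, rfl⟩
    rw [hF', AlternatingMap.map_linearDependent _ _ (hs v hv), map_zero, mul_zero]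
  · rw [hF']
    exact mul_ne_zero two_ne_zero hℓ

lemma not_linearIndependent_of_repr_eq_zero {n t : ℕ} (htn : t < n) {v : Fin n → W}
    (hv : ∀ i, ∀ j : Fin 6, t ≤ j → x.repr (v i) j = 0) : ¬ LinearIndependent k v := by
  classical
  intro hli
  have h1 := finrank_span_eq_card hli
  have h2 : Submodule.span k (Set.range v) ≤
      Submodule.span k (((Finset.univ.filter fun j : Fin 6 => (j : ℕ) < t).image x : Finset W) :
        Set W) := by
    rw [Submodule.span_le]
    rintro _ ⟨i, rfl⟩
    rw [← x.sum_repr (v i)]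
    refine Submodule.sum_mem _ fun j _ => ?_
    by_cases hj : t ≤ j
    · rw [hv i j hj, zero_smul]
      exact zero_mem _
    · refine Submodule.smul_mem _ _ (Submodule.subset_span ?_)
      simp only [Finset.coe_image, Finset.coe_filter, Finset.mem_univ, true_and]
      exact ⟨j, not_le.1 hj, rfl⟩
  have h3 := Submodule.finrank_mono h2
  have h4 := finrank_span_finset_le_card (R := k)
    ((Finset.univ.filter fun j : Fin 6 => (j : ℕ) < t).image x)
  have h5 : ((Finset.univ.filter fun j : Fin 6 => (j : ℕ) < t).image x).card ≤ t := by
    refine Finset.card_image_le.trans ?_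
    rw [← Finset.card_range t]
    exact Finset.card_le_card_of_injOn (fun j => (j : ℕ)) (fun j hj => by simpa using hj)
      (fun a _ b _ h => Fin.ext h)
  rw [Set.finrank] at h4
  rw [Fintype.card_fin] at h1
  omega

/-- The types of the members of a maximal chain of irreducible sets of bivectors of rank at most
`4`, passing through the set of decomposable bivectors. -/
def chainType : ℕ → Fin 4 → ℕ
  | 0 => ![1, 2, 0, 0]
  | 1 => ![1, 3, 0, 0]
  | 2 => ![1, 4, 0, 0]
  | 3 => ![1, 5, 0, 0]
  | 4 => ![1, 6, 0, 0]
  | 5 => ![2, 6, 0, 0]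
  | 6 => ![3, 6, 0, 0]
  | 7 => ![4, 6, 0, 0]
  -- Every plane meets the hyperplane of the flag, so type (5, 6, 0, 0) would define the same cone
  -- as (6, 6, 0, 0).
  | 8 => ![6, 6, 0, 0]
  | 9 => ![6, 6, 1, 2]
  | 10 => ![6, 6, 1, 3]
  | 11 => ![6, 6, 1, 6]
  | 12 => ![6, 6, 2, 6]
  | _ => ![6, 6, 6, 6]

lemma chainType_le_succ (m : ℕ) : chainType m ≤ chainType (m + 1) := by
  by_cases h : m < 13
  · rw [Pi.le_def]
    interval_cases m <;> decide
  · obtain ⟨n, rfl⟩ := Nat.exists_eq_add_of_le (not_lt.1 h)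
    have : ∀ n, chainType (13 + n) = ![6, 6, 6, 6] := fun n => by
      rw [add_comm]; rfl
    rw [add_assoc, this, this]

lemma one_le_chainType_zero (m : ℕ) : 1 ≤ chainType m 0 :=
  (show 1 ≤ chainType 0 0 by decide).trans
    (monotone_nat_of_le_succ chainType_le_succ (Nat.zero_le m) 0)

lemma two_le_chainType_one (m : ℕ) : 2 ≤ chainType m 1 :=
  (show 2 ≤ chainType 0 1 by decide).trans
    (monotone_nat_of_le_succ chainType_le_succ (Nat.zero_le m) 1)

/-- Among decomposable bivectors one coordinate separates consecutive cones; beyond them a quadric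
does. There `e` is chosen so that some of v 2, v 3, x (e 4), x (e 5) are too many vectors for the
member of the flag containing them. -/
lemma projVanishingIdeal_chain_lt [CharZero k] {m : ℕ} (hm : m < 13) :
    projVanishingIdeal (x.exteriorPower 2) (coneLocus (bivectorCone x (chainType (m + 1)))) <
      projVanishingIdeal (x.exteriorPower 2) (coneLocus (bivectorCone x (chainType m))) := by
  have hpair := fun (i j : Fin 6) (hij : i < j) h2 h h' hi hj =>
    projVanishingIdeal_bivectorCone_lt_of_pair x (chainType_le_succ m) (one_le_chainType_zero m)
      (two_le_chainType_one m) h2 hij h h' hi hj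
  have hquad := projVanishingIdeal_bivectorCone_lt_of_quadric x (chainType_le_succ m)
    (one_le_chainType_zero m) (two_le_chainType_one m)
  have hx : ∀ (t : ℕ) (i : Fin 6), i < t → ∀ j : Fin 6, t ≤ j → x.repr (x i) j = 0 := by
    intro t i hi j hj
    rw [x.repr_self, Finsupp.single_apply, if_neg]
    rintro rfl
    omega
  interval_cases m
  · exact hpair 0 2 (by decide) (by decide) (by decide) (by decide) (by decide) (by decide)
  · exact hpair 0 3 (by decide) (by decide) (by decide) (by decide) (by decide) (by decide)
  · exact hpair 0 4 (by decide) (by decide) (by decide) (by decide) (by decide) (by decide)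
  · exact hpair 0 5 (by decide) (by decide) (by decide) (by decide) (by decide) (by decide)
  · exact hpair 1 5 (by decide) (by decide) (by decide) (by decide) (by decide) (by decide)
  · exact hpair 2 5 (by decide) (by decide) (by decide) (by decide) (by decide) (by decide)
  · exact hpair 3 5 (by decide) (by decide) (by decide) (by decide) (by decide) (by decide)
  · exact hpair 4 5 (by decide) (by decide) (by decide) (by decide) (by decide) (by decide)
  -- The third entry of the type is 0, so v 2 = 0.
  · refine hquad ![2, 3, 0, 1, 4, 5] (by decide) (fun v hv hli => ?_) (by decide)
    refine not_linearIndependent_of_repr_eq_zero x (t := 0) (by decide) ?_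
      (hli.comp ![(2 : Fin 6)] (by decide))
    intro i
    fin_cases i
    exact hv 2
  -- v 2, v 3 and x 1 all lie in the span of x 0 and x 1.
  · refine hquad ![3, 4, 0, 2, 1, 5] (by decide) (fun v hv hli => ?_) (by decide)
    refine not_linearIndependent_of_repr_eq_zero x (t := 2) (by decide) ?_
      (hli.comp ![(2 : Fin 6), 3, 4] (by decide))
    intro i
    fin_cases i
    · exact fun j hj => hv 2 j (le_trans (by decide) hj)
    · exact hv 3
    · exact hx 2 1 (by decide)
  · refine hquad ![3, 4, 0, 5, 1, 2] (by decide) (fun v hv hli => ?_) (by decide)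
    refine not_linearIndependent_of_repr_eq_zero x (t := 3) (by decide) ?_
      (hli.comp ![(2 : Fin 6), 3, 4, 5] (by decide))
    intro i
    fin_cases i
    · exact fun j hj => hv 2 j (le_trans (by decide) hj)
    · exact hv 3
    · exact hx 3 1 (by decide)
    · exact hx 3 2 (by decide)
  · refine hquad ![3, 4, 1, 2, 0, 5] (by decide) (fun v hv hli => ?_) (by decide)
    refine not_linearIndependent_of_repr_eq_zero x (t := 1) (by decide) ?_
      (hli.comp ![(2 : Fin 6), 4] (by decide))
    intro i
    fin_cases i
    · exact hv 2
    · exact hx 1 0 (by decide)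
  · refine hquad ![2, 3, 4, 5, 0, 1] (by decide) (fun v hv hli => ?_) (by decide)
    refine not_linearIndependent_of_repr_eq_zero x (t := 2) (by decide) ?_
      (hli.comp ![(2 : Fin 6), 4, 5] (by decide))
    intro i
    fin_cases i
    · exact hv 2
    · exact hx 2 0 (by decide)
    · exact hx 2 1 (by decide)

lemma bivectorCone_chainType_eight : bivectorCone x (chainType 8) = {φ | IsWedgeSum 1 φ} := by
  ext φ
  rw [Set.mem_ofPred_eq, isWedgeSum_one_iff]
  constructor
  · rintro ⟨v, hv, rfl⟩
    have : v 2 = 0 := x.ext_elem fun j => by simpa using hv 2 j (Nat.zero_le _)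
    exact ⟨v 0, v 1, by rw [this, wedge_zero_left, add_zero]⟩
  · rintro ⟨a, c, rfl⟩
    refine ⟨![a, c, 0, 0], ?_, by simp [wedge_zero_left]⟩
    intro r j hj
    have hj6 := j.isLt
    fin_cases r
    · exact absurd hj (by simp [chainType])
    · exact absurd hj (by simp [chainType])
    · simp
    · simp

lemma bivectorCone_chainType_thirteen : bivectorCone x (chainType 13) = {φ | IsWedgeSum 2 φ} := by
  ext φ
  rw [Set.mem_ofPred_eq, isWedgeSum_two_iff]
  constructor
  · rintro ⟨v, hv, rfl⟩
    exact ⟨v 0, v 1, v 2, v 3, rfl⟩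
  · rintro ⟨a, b, c, d, rfl⟩
    refine ⟨![a, b, c, d], ?_, rfl⟩
    intro r j hj
    have hj6 := j.isLt
    exact absurd hj (by fin_cases r <;> simp [chainType])

lemma lineGrassmannian_eq_coneLocus :
    lineGrassmannian k W = coneLocus (bivectorCone x (chainType 8)) := by
  rw [bivectorCone_chainType_eight]
  ext p
  exact mem_lineGrassmannian_iff

lemma pfaffianLocus_eq_coneLocus [CharZero k] :
    pfaffianLocus k W = coneLocus (bivectorCone x (chainType 13)) := by
  rw [bivectorCone_chainType_thirteen]
  ext p
  exact pow_three_eq_zero_iff (by rw [Module.finrank_eq_card_basis x, Fintype.card_fin])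

lemma lineGrassmannian_eq_pow_two [CharZero k] (hW : Module.finrank k W = 6) :
    lineGrassmannian k W = {p | (p.rep : ExteriorAlgebra k W) ^ 2 = 0} := by
  ext p
  exact mem_lineGrassmannian_iff.trans (pow_two_eq_zero_iff_isWedgeSum hW).symm

/-- The Pfaffian cubic. -/
lemma exists_pfaffian [CharZero k] :
    ∃ (ℓ : ExteriorAlgebra k W →ₗ[k] k) (F : MvPolynomial (Set.powersetCard (Fin 6) 2) k),
      ℓ (ExteriorAlgebra.ιMulti k 6 x) ≠ 0 ∧ F.IsHomogeneous 3 ∧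
      ∀ φ : ⋀[k]^2 W,
        eval ((x.exteriorPower 2).repr φ) F = ℓ ((φ : ExteriorAlgebra k W) ^ 3) := by
  have hτ : ∃ ℓ : Module.Dual k (ExteriorAlgebra k W), ℓ (ExteriorAlgebra.ιMulti k 6 x) ≠ 0 := by
    by_contra! h
    exact ιMulti_ne_zero x.linearIndependent ((Module.forall_dual_apply_eq_zero_iff k _).1 h)
  obtain ⟨ℓ, hℓ⟩ := hτ
  obtain ⟨F, hF⟩ := exists_isHomogeneous_eval_eq_pow (x.exteriorPower 2) 3 ℓ
  exact ⟨ℓ, F, hℓ, hF⟩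

/-- φ³ lies in the line ⋀⁶W, on which a functional that is not identically zero is injective. -/
lemma eval_pfaffian_ne_zero [CharZero k] {ℓ : ExteriorAlgebra k W →ₗ[k] k}
    (hℓ : ℓ (ExteriorAlgebra.ιMulti k 6 x) ≠ 0) {φ : ⋀[k]^2 W}
    (hφ : (φ : ExteriorAlgebra k W) ^ 3 ≠ 0) : ℓ ((φ : ExteriorAlgebra k W) ^ 3) ≠ 0 := by
  have hW : Module.finrank k W = 6 := by rw [Module.finrank_eq_card_basis x, Fintype.card_fin]
  have : Module.Finite k W := Module.finite_of_finrank_pos (by omega)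
  have h1 : (φ : ExteriorAlgebra k W) ^ 3 ∈ ⋀[k]^6 W := by
    have := Submodule.pow_mem_pow _ φ.2 3
    rwa [← pow_mul] at this
  have h2 : Module.finrank k (⋀[k]^6 W) = 1 := by
    rw [exteriorPower.finrank_eq, hW]
    rfl
  obtain ⟨c, hc⟩ := (finrank_eq_one_iff_of_nonzero' (⟨_, h1⟩ : ⋀[k]^6 W)
    (fun h => hφ (congrArg Subtype.val h))).1 h2 (exteriorPower.ιMulti k 6 x)
  have hc' : c • (φ : ExteriorAlgebra k W) ^ 3 = ExteriorAlgebra.ιMulti k 6 x :=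
    congrArg Subtype.val hc
  intro h
  apply hℓ
  rw [← hc', map_smul, h, smul_zero]

lemma exists_pow_three_ne_zero [CharZero k] :
    ((wedge (x 0) (x 1) + (wedge (x 2) (x 3) + wedge (x 4) (x 5)) : ⋀[k]^2 W) :
      ExteriorAlgebra k W) ^ 3 ≠ 0 := by
  rw [coe_wedge_add_wedge_add_wedge_pow_three, Ne]
  refine (not_congr (ofNat_mul_eq_zero_iff (n := 6) (by norm_num))).2 (ιMulti_ne_zero ?_)
  convert x.linearIndependent using 1
  ext i
  fin_cases i <;> rfl

lemma projVanishingIdeal_pfaffianLocus_ne_bot [CharZero k] :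
    projVanishingIdeal (x.exteriorPower 2) (coneLocus (bivectorCone x (chainType 13))) ≠ ⊥ := by
  obtain ⟨ℓ, F, hℓ, hF3, hF⟩ := exists_pfaffian x
  intro h
  have hmem : F ∈ projVanishingIdeal (x.exteriorPower 2)
      (coneLocus (bivectorCone x (chainType 13))) := by
    rw [mem_projVanishingIdeal_coneLocus (isCone_bivectorCone x _)
      (exists_ne_zero_mem_bivectorCone x (one_le_chainType_zero 13) (two_le_chainType_one 13))]
    rintro _ ⟨v, -, rfl⟩
    rw [hF, coe_wedge_add_wedge_pow_three, map_zero]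
  rw [h, Ideal.mem_bot] at hmem
  refine eval_pfaffian_ne_zero x hℓ (exists_pow_three_ne_zero x) ?_
  rw [← hF, hmem, map_zero]

lemma projDim_chain [CharZero k] {m : ℕ} (hm : m ≤ 13)
    (hcl : @IsClosed _ (projZariskiTopology (x.exteriorPower 2))
      (coneLocus (bivectorCone x (chainType m)))) :
    projDim (x.exteriorPower 2) (coneLocus (bivectorCone x (chainType m))) = m := by
  refine projDim_eq_of_chain (x.exteriorPower 2) (N := 13) ?_
    (fun m => coneLocus (bivectorCone x (chainType m))) ?_ ?_ ?_ ?_ hm hcl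
  · rw [Set.powersetCard.card, Nat.card_eq_fintype_card, Fintype.card_fin]
    rfl
  · intro m n hmn p hp
    exact bivectorCone_mono x (monotone_nat_of_le_succ chainType_le_succ hmn) hp
  · exact fun m _ => isPrime_projVanishingIdeal_bivectorCone x (one_le_chainType_zero m)
      (two_le_chainType_one m)
  · exact fun m hm => projVanishingIdeal_chain_lt x hm
  · exact projVanishingIdeal_pfaffianLocus_ne_bot x

end PluckerCoordinates

/-! ### Tangent vectors via lines; adapted bases -/

section TangentSpaces

variable {k V ι : Type*} [Field k] [AddCommGroup V] [Module k V]

open MvPolynomial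

lemma mem_projTangentSpace_iff [Fintype ι] {b : Module.Basis ι k V} {X : Set (ℙ k V)}
    {p : ℙ k V} {v : V} :
    v ∈ projTangentSpace b X p ↔
      ∀ f ∈ projVanishingIdeal b X, (linePolynomial b f p.rep v).derivative.eval 0 = 0 := by
  simp only [projTangentSpace, Submodule.mem_iInf, LinearMap.mem_ker,
    eval_zero_derivative_linePolynomial]

/-- A line through `p` contained in the cone over `X` is tangent to `X`. -/
lemma mem_projTangentSpace_of_line [Infinite k] [Fintype ι] {b : Module.Basis ι k V} {T : Set V}
    (hT : IsCone k T) {p : ℙ k V} {v : V} (h : ∀ t : k, p.rep + t • v ∈ T) :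
    v ∈ projTangentSpace b (coneLocus T) p := by
  rw [mem_projTangentSpace_iff]
  intro f hf
  have hp : p.rep ∈ T := by simpa using h 0
  rw [mem_projVanishingIdeal_coneLocus hT ⟨_, hp, p.rep_nonzero⟩] at hf
  have : linePolynomial b f p.rep v = 0 :=
    Polynomial.funext fun t => by rw [eval_linePolynomial, hf _ (h t), Polynomial.eval_zero]
  rw [this, Polynomial.derivative_zero, Polynomial.eval_zero]

/-- The restriction of f to the line may be replaced by any polynomial with the same values, so its
derivative can be read off from an explicit expansion. -/
lemma eval_zero_derivative_eq_zero_of_mem_projTangentSpace [Infinite k] [Fintype ι]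
    {b : Module.Basis ι k V} {X : Set (ℙ k V)} {p : ℙ k V} {v : V}
    (hv : v ∈ projTangentSpace b X p) {f : MvPolynomial ι k} (hf : f ∈ projVanishingIdeal b X)
    {q : Polynomial k} (hq : ∀ t : k, eval (b.repr (p.rep + t • v)) f = q.eval t) :
    q.derivative.eval 0 = 0 := by
  have : linePolynomial b f p.rep v = q :=
    Polynomial.funext fun t => by rw [eval_linePolynomial, hq]
  rw [← this]
  exact mem_projTangentSpace_iff.1 hv f hf

lemma finrank_eq_card_of_basis_mem (B : Module.Basis ι k V) [Fintype ι] (T : Submodule k V)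
    (s : ι → Prop) [Fintype {i // s i}] (h : ∀ i, s i → B i ∈ T)
    (h' : ∀ v ∈ T, ∀ i, ¬ s i → B.repr v i = 0) :
    Module.finrank k T = Fintype.card {i // s i} := by
  classical
  have hT : T = Submodule.span k (Set.range fun i : {i // s i} => B i) := by
    apply le_antisymm
    · intro v hv
      rw [← B.sum_repr v]
      refine Submodule.sum_mem _ fun i _ => ?_
      by_cases hi : s i
      · exact Submodule.smul_mem _ _ (Submodule.subset_span ⟨⟨i, hi⟩, rfl⟩)
      · rw [h' v hv i hi, zero_smul]
        exact zero_mem _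
    · rw [Submodule.span_le]
      rintro _ ⟨i, rfl⟩
      exact h i i.2
  rw [hT]
  exact finrank_span_eq_card (B.linearIndependent.comp _ Subtype.val_injective)

lemma exists_basis_extending {n m : ℕ} (hV : Module.finrank k V = n) (hn : n ≠ 0) {v : Fin m → V}
    (hv : LinearIndependent k v) :
    ∃ (hmn : m ≤ n) (y : Module.Basis (Fin n) k V), ∀ i : Fin m, y (i.castLE hmn) = v i := by
  have : Module.Finite k V := Module.finite_of_finrank_pos (by omega)
  have hmn : m ≤ n := by
    have := hv.fintype_card_le_finrank
    rwa [Fintype.card_fin, hV] at this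
  obtain ⟨d, rfl⟩ := Nat.exists_eq_add_of_le hmn
  let B := Module.Basis.sumExtend hv
  have hfin : Finite (Fin m ⊕ Module.Basis.sumExtendIndex hv) :=
    Module.Finite.finite_basis B
  have : Finite (Module.Basis.sumExtendIndex hv) := Finite.sum_right (Fin m)
  have := Fintype.ofFinite (Module.Basis.sumExtendIndex hv)
  have hcard : Fintype.card (Module.Basis.sumExtendIndex hv) = d := by
    have := Module.finrank_eq_card_basis B
    rw [hV, Fintype.card_sum, Fintype.card_fin] at this
    omega
  let e : Fin m ⊕ Module.Basis.sumExtendIndex hv ≃ Fin (m + d) :=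
    (Equiv.sumCongr (Equiv.refl _) (Fintype.equivFinOfCardEq hcard)).trans finSumFinEquiv
  refine ⟨hmn, B.reindex e, fun i => ?_⟩
  have : i.castLE hmn = e (Sum.inl i) := by
    ext
    simp [e]
  rw [this, Module.Basis.reindex_apply, Equiv.symm_apply_apply]
  simp only [B, Module.Basis.sumExtend, Module.Basis.reindex_apply, Module.Basis.extend_apply_self]
  rfl

end TangentSpaces

/-! ### Tangent spaces to the Grassmannian and to the Pfaffian locus -/

section BivectorTangentSpaces

variable {k W : Type*} [Field k] [AddCommGroup W] [Module k W]

open MvPolynomial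

/-- Two-element subsets of `Fin 6` as increasing pairs. -/
def pairEquiv : Set.powersetCard (Fin 6) 2 ≃ {p : Fin 6 × Fin 6 // p.1 < p.2} where
  toFun P := ⟨(pairFst P, pairSnd P), pairFst_lt_pairSnd P⟩
  invFun p := pairMk p.1.1 p.1.2 p.2
  left_inv P := by
    apply Set.powersetCard.ofFinEmbEquiv.symm.injective
    ext i
    fin_cases i
    · exact congrArg Fin.val (pairFst_pairMk (pairFst_lt_pairSnd P))
    · exact congrArg Fin.val (pairSnd_pairMk (pairFst_lt_pairSnd P))
  right_inv p := Subtype.ext (Prod.ext (pairFst_pairMk p.2) (pairSnd_pairMk p.2))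

lemma card_pairFst_lt (n : ℕ) [Fintype {P // pairFst P < n}] : Fintype.card {P // pairFst P < n} =
    Fintype.card {p : {p : Fin 6 × Fin 6 // p.1 < p.2} // p.1.1 < n} :=
  Fintype.card_congr (pairEquiv.subtypeEquiv fun _ => Iff.rfl)

lemma commute_wedge (a c : W) (ψ : ⋀[k]^2 W) :
    Commute ((wedge a c : ⋀[k]^2 W) : ExteriorAlgebra k W) ψ := by
  have hψ : ψ ∈ Submodule.span k {φ : ⋀[k]^2 W | ∃ a c, φ = wedge a c} := by
    rw [span_range_wedge]
    trivial
  induction hψ using Submodule.span_induction with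
  | mem ψ h =>
    obtain ⟨e, f, rfl⟩ := h
    rw [coe_wedge, coe_wedge]
    exact ι_mul_ι_commute' a c e f
  | zero => exact Commute.zero_right _
  | add ψ ψ' _ _ h h' => exact h.add_right h'
  | smul t ψ _ h => exact h.smul_right t

lemma eq_of_injective_pair : ∀ {i j i' j' l m : Fin 6},
    Function.Injective ![0, 1, i, j, l, m] → Function.Injective ![0, 1, i', j', l, m] →
    i < j → i' < j' → i' = i ∧ j' = j := by
  intro i j i' j' l m h h' hij hij'
  have e := fun r s (hrs : r ≠ s) => h.ne hrs
  have e' := fun r s (hrs : r ≠ s) => h'.ne hrs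
  have h1 := e 0 2 (by decide)
  have h2 := e 0 3 (by decide)
  have h3 := e 0 4 (by decide)
  have h4 := e 0 5 (by decide)
  have h5 := e 1 2 (by decide)
  have h6 := e 1 3 (by decide)
  have h7 := e 1 4 (by decide)
  have h8 := e 1 5 (by decide)
  have h9 := e 2 4 (by decide)
  have h10 := e 2 5 (by decide)
  have h11 := e 3 4 (by decide)
  have h12 := e 3 5 (by decide)
  have h13 := e 4 5 (by decide)
  have k1 := e' 0 2 (by decide)
  have k2 := e' 0 3 (by decide)
  have k3 := e' 1 2 (by decide)
  have k4 := e' 1 3 (by decide)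
  have k5 := e' 2 4 (by decide)
  have k6 := e' 2 5 (by decide)
  have k7 := e' 3 4 (by decide)
  have k8 := e' 3 5 (by decide)
  simp [Fin.ext_iff] at *
  omega

lemma exists_injective_pair : ∀ i j : Fin 6, ¬ i < (2 : ℕ) → i < j →
    ∃ l m : Fin 6, Function.Injective ![0, 1, i, j, l, m] := by
  decide

/-- Let l, m be the indices outside {0, 1} and P. Multiplying further by y_l∧y_m kills every basis
bivector except that of P, which goes to a nonzero top form, so the P-coordinate is isolated. -/
lemma repr_eq_zero_of_mul_eq_zero (y : Module.Basis (Fin 6) k W) {ψ : ⋀[k]^2 W}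
    (h : ((wedge (y 0) (y 1) : ⋀[k]^2 W) : ExteriorAlgebra k W) * ψ = 0)
    {P : Set.powersetCard (Fin 6) 2} (hP : ¬ pairFst P < (2 : ℕ)) :
    (y.exteriorPower 2).repr ψ P = 0 := by
  obtain ⟨l, m, hlm⟩ := exists_injective_pair _ _ hP (pairFst_lt_pairSnd P)
  let L : ⋀[k]^2 W →ₗ[k] ExteriorAlgebra k W :=
    LinearMap.mulRight k (ExteriorAlgebra.ι k (y l) * ExteriorAlgebra.ι k (y m)) ∘ₗ
      LinearMap.mulLeft k (((wedge (y 0) (y 1) : ⋀[k]^2 W) : ExteriorAlgebra k W)) ∘ₗ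
      (⋀[k]^2 W).subtype
  have hL : ∀ Q, L (y.exteriorPower 2 Q) =
      ExteriorAlgebra.ιMulti k 6 (y ∘ ![0, 1, pairFst Q, pairSnd Q, l, m]) := by
    intro Q
    rw [exteriorPower_basis_eq_wedge]
    simp only [L, LinearMap.comp_apply, LinearMap.mulRight_apply, LinearMap.mulLeft_apply,
      Submodule.subtype_apply, coe_wedge]
    simp only [ExteriorAlgebra.ιMulti_apply, List.ofFn_succ, List.ofFn_zero, List.prod_cons,
      List.prod_nil, mul_one, mul_assoc]
    rfl
  have hL0 : L ψ = 0 := by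
    simp [L, h]
  rw [← (y.exteriorPower 2).sum_repr ψ, map_sum, Finset.sum_eq_single P] at hL0
  · rw [map_smul, hL, smul_eq_zero] at hL0
    exact hL0.resolve_right (ιMulti_ne_zero (y.linearIndependent.comp _ hlm))
  · intro Q _ hQP
    rw [map_smul, hL, AlternatingMap.map_eq_zero_of_not_injective, smul_zero]
    intro hinj
    apply hQP
    obtain ⟨h1, h2⟩ := eq_of_injective_pair hlm (hinj.of_comp) (pairFst_lt_pairSnd P)
      (pairFst_lt_pairSnd Q)
    exact pairEquiv.injective (Subtype.ext (Prod.ext h1 h2))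
  · intro hP
    exact absurd (Finset.mem_univ P) hP

variable (x : Module.Basis (Fin 6) k W)

/-- In a basis with the point at y 0∧y 1, the nine bivectors y_i∧y_j with i < 2, i < j are
directions of lines in the cone. Differentiating φ² = 0 gives y 0∧y 1∧ψ = 0, which kills the other
six coordinates. -/
lemma finrank_projTangentSpace_lineGrassmannian [CharZero k] {p : ℙ k (⋀[k]^2 W)}
    (hp : p ∈ lineGrassmannian k W) :
    Module.finrank k (projTangentSpace (x.exteriorPower 2) (lineGrassmannian k W) p) = 9 := by
  classical
  have hW : Module.finrank k W = 6 := by rw [Module.finrank_eq_card_basis x, Fintype.card_fin]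
  obtain ⟨a, c, hac⟩ := isWedgeSum_one_iff.1 (mem_lineGrassmannian_iff.1 hp)
  have hli : LinearIndependent k ![a, c] := by
    by_contra hli
    exact p.rep_nonzero
      (hac.trans (AlternatingMap.map_linearDependent (exteriorPower.ιMulti k 2) _ hli))
  obtain ⟨hmn, y, hy⟩ := exists_basis_extending hW (by decide) hli
  obtain rfl : y 0 = a := hy 0
  obtain rfl : y 1 = c := hy 1
  rw [finrank_eq_card_of_basis_mem (y.exteriorPower 2) _ (fun P => pairFst P < (2 : ℕ)),
    card_pairFst_lt]
  · decide
  · intro P hP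
    rw [lineGrassmannian_eq_coneLocus x]
    refine mem_projTangentSpace_of_line (isCone_bivectorCone x _) fun t => ?_
    rw [bivectorCone_chainType_eight, Set.mem_ofPred_eq, isWedgeSum_one_iff, hac,
      exteriorPower_basis_eq_wedge]
    obtain h | h : pairFst P = 0 ∨ pairFst P = 1 := by omega
    · refine ⟨y 0, y 1 + t • y (pairSnd P), ?_⟩
      rw [h, wedge_add_right, wedge_smul_right]
    -- (y 0 - t y_j)∧y 1 = y 0∧y 1 + t y 1∧y_j.
    · refine ⟨y 0 + (-t) • y (pairSnd P), y 1, ?_⟩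
      rw [h, wedge_add_left, wedge_smul_left, wedge_swap (y 1)]
      module
  · intro ψ hψ P hP
    refine repr_eq_zero_of_mul_eq_zero y ?_ hP
    have hcomm := (commute_wedge (y 0) (y 1) ψ).eq
    have h2 : ((wedge (y 0) (y 1) : ⋀[k]^2 W) : ExteriorAlgebra k W) * ψ +
        ψ * (wedge (y 0) (y 1) : ⋀[k]^2 W) = 0 := by
      refine (Module.forall_dual_apply_eq_zero_iff k _).1 fun ℓ => ?_
      obtain ⟨F, hF, hFe⟩ := exists_isHomogeneous_eval_eq_pow (x.exteriorPower 2) 2 ℓ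
      have hFmem : F ∈ projVanishingIdeal (x.exteriorPower 2) (lineGrassmannian k W) := by
        rw [mem_projVanishingIdeal_iff hF, lineGrassmannian_eq_pow_two hW]
        intro q hq
        simp only [projZeroLocus, Set.mem_ofPred_eq] at hq ⊢
        rw [hFe, hq, map_zero]
      -- The polynomial is the expansion of ℓ((φ + tψ)²); its constant term drops out because φ² =
      -- 0.
      have := eval_zero_derivative_eq_zero_of_mem_projTangentSpace hψ hFmem
        (q := Polynomial.C (ℓ ((wedge (y 0) (y 1) : ⋀[k]^2 W) * ψ +
          ψ * (wedge (y 0) (y 1) : ⋀[k]^2 W))) * Polynomial.X +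
          Polynomial.C (ℓ ((ψ : ExteriorAlgebra k W) ^ 2)) * Polynomial.X ^ 2) (by
          intro t
          rw [hFe, hac, Submodule.coe_add, sq, add_mul, mul_add, mul_add, ← sq, coe_wedge_pow_two]
          simp only [Submodule.coe_smul, mul_smul_comm, smul_mul_assoc, map_add, map_smul,
            Polynomial.eval_add, Polynomial.eval_mul, Polynomial.eval_C, Polynomial.eval_X,
            smul_eq_mul, map_zero, sq]
          ring)
      simpa using this
    rw [← hcomm, ← two_mul] at h2
    exact (ofNat_mul_eq_zero_iff (n := 2) (by norm_num)).1 h2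

/-- Adding a decomposable bivector to a decomposable one stays inside the cubic, so every
decomposable direction is tangent, and these span. -/
lemma projTangentSpace_pfaffianLocus_of_mem_lineGrassmannian [CharZero k] {p : ℙ k (⋀[k]^2 W)}
    (hp : p ∈ lineGrassmannian k W) :
    projTangentSpace (x.exteriorPower 2) (pfaffianLocus k W) p = ⊤ := by
  rw [eq_top_iff, ← span_range_wedge, Submodule.span_le]
  rintro _ ⟨c, d, rfl⟩
  rw [pfaffianLocus_eq_coneLocus x]
  refine mem_projTangentSpace_of_line (isCone_bivectorCone x _) fun t => ?_
  obtain ⟨a, b, hab⟩ := isWedgeSum_one_iff.1 (mem_lineGrassmannian_iff.1 hp)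
  rw [bivectorCone_chainType_thirteen, Set.mem_ofPred_eq, isWedgeSum_two_iff, hab]
  exact ⟨a, b, t • c, d, by rw [wedge_smul_left]⟩

/-- At y 0∧y 1 + y 2∧y 3, fourteen basis directions stay in the cone along lines. In the direction y
4∧y 5 the Pfaffian is linear in t with coefficient 6ℓ(y 0∧…∧y 5) ≠ 0. -/
lemma finrank_projTangentSpace_pfaffianLocus [CharZero k] {p : ℙ k (⋀[k]^2 W)}
    (hp : p ∈ pfaffianLocus k W) (hp' : p ∉ lineGrassmannian k W) :
    Module.finrank k (projTangentSpace (x.exteriorPower 2) (pfaffianLocus k W) p) = 14 := by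
  classical
  have hW : Module.finrank k W = 6 := by rw [Module.finrank_eq_card_basis x, Fintype.card_fin]
  obtain ⟨a, b, c, d, habcd⟩ := isWedgeSum_two_iff.1 ((pow_three_eq_zero_iff hW).1 hp)
  have hli : LinearIndependent k ![a, b, c, d] := by
    by_contra hli
    apply hp'
    rw [lineGrassmannian_eq_pow_two hW, Set.mem_ofPred_eq, habcd, coe_wedge_add_wedge_pow_two,
      AlternatingMap.map_linearDependent _ _ hli, mul_zero]
  obtain ⟨hmn, y, hy⟩ := exists_basis_extending hW (by decide) hli
  obtain rfl : y 0 = a := hy 0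
  obtain rfl : y 1 = b := hy 1
  obtain rfl : y 2 = c := hy 2
  obtain rfl : y 3 = d := hy 3
  have hmem : ∀ P, pairFst P < (4 : ℕ) →
      y.exteriorPower 2 P ∈ projTangentSpace (x.exteriorPower 2) (pfaffianLocus k W) p := by
    intro P hP
    rw [pfaffianLocus_eq_coneLocus x]
    refine mem_projTangentSpace_of_line (isCone_bivectorCone x _) fun t => ?_
    rw [bivectorCone_chainType_thirteen, Set.mem_ofPred_eq, isWedgeSum_two_iff, habcd,
      exteriorPower_basis_eq_wedge]
    obtain h | h | h | h : pairFst P = 0 ∨ pairFst P = 1 ∨ pairFst P = 2 ∨ pairFst P = 3 := by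
      omega
    · refine ⟨y 0, y 1 + t • y (pairSnd P), y 2, y 3, ?_⟩
      rw [h, wedge_add_right, wedge_smul_right]
      abel
    · refine ⟨y 0 + (-t) • y (pairSnd P), y 1, y 2, y 3, ?_⟩
      rw [h, wedge_add_left, wedge_smul_left, wedge_swap (y 1)]
      module
    · refine ⟨y 0, y 1, y 2, y 3 + t • y (pairSnd P), ?_⟩
      rw [h, wedge_add_right, wedge_smul_right]
      abel
    · refine ⟨y 0, y 1, y 2 + (-t) • y (pairSnd P), y 3, ?_⟩
      rw [h, wedge_add_left, wedge_smul_left, wedge_swap (y 3)]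
      module
  rw [finrank_eq_card_of_basis_mem (y.exteriorPower 2) _ (fun P => pairFst P < (4 : ℕ)) hmem,
    card_pairFst_lt]
  · decide
  · intro ψ hψ P hP
    have hP4 : pairFst P = 4 ∧ pairSnd P = 5 := by
      have := pairFst_lt_pairSnd P
      omega
    have huniq : ∀ Q, ¬ pairFst Q < (4 : ℕ) → Q = P := by
      intro Q hQ
      have hQ4 : pairFst Q = 4 ∧ pairSnd Q = 5 := by
        have := pairFst_lt_pairSnd Q
        omega
      exact pairEquiv.injective (Subtype.ext (Prod.ext (hQ4.1.trans hP4.1.symm)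
        (hQ4.2.trans hP4.2.symm)))
    -- Subtracting the known tangent vectors from one with nonzero P-coordinate would make y 4∧y 5
    -- itself tangent.
    by_contra hcon
    have hPmem : y.exteriorPower 2 P ∈
        projTangentSpace (x.exteriorPower 2) (pfaffianLocus k W) p := by
      have h1 := (y.exteriorPower 2).sum_repr ψ
      rw [← Finset.add_sum_erase _ _ (Finset.mem_univ P)] at h1
      rw [← h1] at hψ
      rw [Submodule.add_mem_iff_left] at hψ
      · exact (Submodule.smul_mem_iff _ hcon).1 hψ
      · refine Submodule.sum_mem _ fun Q hQ => Submodule.smul_mem _ _ (hmem Q ?_)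
        by_contra hQ'
        exact Finset.ne_of_mem_erase hQ (huniq Q hQ')
    rw [exteriorPower_basis_eq_wedge, hP4.1, hP4.2] at hPmem
    obtain ⟨ℓ, F, hℓ, hF3, hF⟩ := exists_pfaffian x
    have hFmem : F ∈ projVanishingIdeal (x.exteriorPower 2) (pfaffianLocus k W) := by
      rw [mem_projVanishingIdeal_iff hF3]
      intro q hq
      simp only [projZeroLocus, pfaffianLocus, Set.mem_ofPred_eq] at hq ⊢
      rw [hF, hq, map_zero]
    have := eval_zero_derivative_eq_zero_of_mem_projTangentSpace hPmem hFmem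
      (q := Polynomial.C (ℓ (6 * ExteriorAlgebra.ιMulti k 6 ![y 0, y 1, y 2, y 3, y 4, y 5])) *
        Polynomial.X) (by
        intro t
        rw [hF, habcd, ← wedge_smul_left, add_assoc, coe_wedge_add_wedge_add_wedge_pow_three]
        have : ExteriorAlgebra.ιMulti k 6 ![y 0, y 1, y 2, y 3, t • y 4, y 5] =
            t • ExteriorAlgebra.ιMulti k 6 ![y 0, y 1, y 2, y 3, y 4, y 5] := by
          simp [ExteriorAlgebra.ιMulti_apply]
        rw [this, mul_smul_comm, map_smul, Polynomial.eval_mul, Polynomial.eval_C,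
          Polynomial.eval_X, smul_eq_mul, mul_comm])
    rw [← coe_wedge_add_wedge_add_wedge_pow_three] at this
    refine eval_pfaffian_ne_zero x hℓ (exists_pow_three_ne_zero y) ?_
    simpa using this

end BivectorTangentSpaces

/-! ### Irreducibility of the Pfaffian cubic -/

section PfaffianIrreducible

variable {k W : Type*} [Field k] [AddCommGroup W] [Module k W]

open MvPolynomial

/-- Setting the variables outside A to zero deletes precisely the monomials not supported in A. -/
lemma coeff_aeval_ite {ι : Type*} [DecidableEq ι] (A : Finset ι) {m : ι →₀ ℕ}
    (hm : m.support ⊆ A) (f : MvPolynomial ι k) :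
    coeff m (aeval (fun i => if i ∈ A then (X i : MvPolynomial ι k) else 0) f) = coeff m f := by
  induction f using MvPolynomial.monomial_add_induction_on with
  | C a => simp [algebraMap_eq]
  | monomial_add d c f _ _ ih =>
    rw [map_add, coeff_add, coeff_add, ih, aeval_monomial]
    congr 1
    by_cases hd : d.support ⊆ A
    · rw [Finsupp.prod_congr (g2 := fun i n => (X i : MvPolynomial ι k) ^ n) (fun i hi => by
        rw [if_pos (hd hi)]), algebraMap_eq, ← monomial_eq]
    · obtain ⟨i, hi, hiA⟩ := Finset.not_subset.1 hd
      rw [Finsupp.prod, Finset.prod_eq_zero hi (by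
        rw [if_neg hiA, zero_pow (Finsupp.mem_support_iff.1 hi)]), mul_zero, coeff_zero,
        coeff_monomial, if_neg]
      rintro rfl
      exact hd hm

/-- A polynomial vanishing on all linear combinations of two basis vectors has no nonzero terms
of degree at most two. -/
lemma eq_zero_of_totalDegree_le_two [Infinite k] {ι : Type*} [Nonempty ι] {f : MvPolynomial ι k}
    (hf : f.totalDegree ≤ 2)
    (h : ∀ (i j : ι) (y : ι → k), (∀ l, l ≠ i → l ≠ j → y l = 0) → eval y f = 0) : f = 0 := by
  classical
  ext m
  rw [coeff_zero]
  by_contra hm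
  have hdeg : m.degree ≤ 2 := (le_totalDegree (mem_support_iff.2 hm)).trans hf
  have hcard : m.support.card ≤ 2 := by
    refine le_trans ?_ hdeg
    rw [Finsupp.degree_apply, Finset.card_eq_sum_ones]
    exact Finset.sum_le_sum fun i hi => Nat.one_le_iff_ne_zero.2 (Finsupp.mem_support_iff.1 hi)
  have hA : ∃ A : Finset ι, m.support ⊆ A ∧
      ∀ y : ι → k, (∀ l, l ∉ A → y l = 0) → eval y f = 0 := by
    refine ⟨m.support, subset_rfl, fun y hy => ?_⟩
    -- When the support has fewer than two elements, the hypothesis is used with i = j.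
    rcases Nat.lt_or_ge m.support.card 2 with h2 | h2
    · rcases Finset.eq_empty_or_nonempty m.support with h0 | ⟨i, hi⟩
      · have hy0 : y = 0 := funext fun l => hy l (by simp [h0])
        obtain ⟨i⟩ := ‹Nonempty ι›
        exact h i i y fun l _ _ => by rw [hy0]; rfl
      · have h1 := Finset.card_le_one.1 (Nat.lt_succ_iff.1 h2)
        refine h i i y fun l hl _ => hy l fun hlm => hl (h1 l hlm i hi)
    · obtain ⟨i, j, -, hij⟩ := Finset.card_eq_two.1 (le_antisymm hcard h2)
      refine h i j y fun l hi hj => hy l ?_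
      simp [hij, hi, hj]
  obtain ⟨A, hmA, hA⟩ := hA
  apply hm
  rw [← coeff_aeval_ite A hmA]
  have : aeval (fun i => if i ∈ A then (X i : MvPolynomial ι k) else 0) f = 0 := by
    refine MvPolynomial.funext fun y => ?_
    have hcomp : eval y (aeval (fun i => if i ∈ A then (X i : MvPolynomial ι k) else 0) f) =
        eval (fun i => if i ∈ A then y i else 0) f := by
      rw [← coe_aeval_eq_eval, ← coe_aeval_eq_eval]
      change aeval y (aeval _ f) = aeval _ f
      rw [← AlgHom.comp_apply, comp_aeval]
      congr 2
      ext i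
      split_ifs <;> simp
    rw [hcomp, map_zero]
    exact hA _ fun l hl => by simp [hl]
  rw [this, coeff_zero]

variable (x : Module.Basis (Fin 6) k W)

/-- A combination of two basis bivectors is a sum of two wedges, so f vanishes on all coordinate
planes; a monomial of degree at most 2 involves at most two variables. -/
lemma eq_zero_of_mem_projVanishingIdeal_pfaffianLocus [CharZero k]
    {f : MvPolynomial (Set.powersetCard (Fin 6) 2) k}
    (hf : f ∈ projVanishingIdeal (x.exteriorPower 2) (pfaffianLocus k W))
    (hdeg : f.totalDegree ≤ 2) : f = 0 := by
  classical
  rw [pfaffianLocus_eq_coneLocus x, mem_projVanishingIdeal_coneLocus (isCone_bivectorCone x _)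
    (exists_ne_zero_mem_bivectorCone x (one_le_chainType_zero 13) (two_le_chainType_one 13)),
    bivectorCone_chainType_thirteen] at hf
  have : Nonempty (Set.powersetCard (Fin 6) 2) := ⟨pairMk 0 1 (by decide)⟩
  refine eq_zero_of_totalDegree_le_two hdeg fun P Q y hy => ?_
  have hmem : IsWedgeSum 2 (∑ R, y R • x.exteriorPower 2 R) := by
    rw [isWedgeSum_two_iff]
    by_cases hPQ : P = Q
    · subst hPQ
      refine ⟨y P • x (pairFst P), x (pairSnd P), 0, 0, ?_⟩
      rw [Finset.sum_eq_single P, exteriorPower_basis_eq_wedge, wedge_smul_left, wedge_zero_left,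
        add_zero]
      · intro R _ hR
        rw [hy R hR hR, zero_smul]
      · simp
    · refine ⟨y P • x (pairFst P), x (pairSnd P), y Q • x (pairFst Q), x (pairSnd Q), ?_⟩
      rw [← Finset.sum_subset (Finset.subset_univ {P, Q}), Finset.sum_pair hPQ,
        exteriorPower_basis_eq_wedge, exteriorPower_basis_eq_wedge, wedge_smul_left,
        wedge_smul_left]
      intro R _ hR
      simp only [Finset.mem_insert, Finset.mem_singleton, not_or] at hR
      rw [hy R hR.1 hR.2, zero_smul]
  have := hf _ hmem
  rwa [Module.Basis.repr_sum_self] at this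

/-- In a factorisation of the cubic, one factor lies in the prime ideal of the locus, hence has
degree at least 3, and the other is constant. -/
lemma isIrreducibleHypersurface_pfaffianLocus [CharZero k] :
    IsIrreducibleHypersurface (x.exteriorPower 2) (pfaffianLocus k W) 3 := by
  obtain ⟨ℓ, F, hℓ, hF3, hF⟩ := exists_pfaffian x
  have hF0 : F ≠ 0 := by
    rintro rfl
    refine eval_pfaffian_ne_zero x hℓ (exists_pow_three_ne_zero x) ?_
    rw [← hF, map_zero]
  have heq : pfaffianLocus k W = projZeroLocus (x.exteriorPower 2) F := by
    ext p
    simp only [pfaffianLocus, projZeroLocus, Set.mem_ofPred_eq, hF]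
    exact ⟨fun h => by rw [h, map_zero], fun h => by
      by_contra h0
      exact eval_pfaffian_ne_zero x hℓ h0 h⟩
  have hmem : F ∈ projVanishingIdeal (x.exteriorPower 2) (pfaffianLocus k W) :=
    (mem_projVanishingIdeal_iff hF3).2 heq.subset
  have hprime : (projVanishingIdeal (x.exteriorPower 2) (pfaffianLocus k W)).IsPrime := by
    rw [pfaffianLocus_eq_coneLocus x]
    exact isPrime_projVanishingIdeal_bivectorCone x (one_le_chainType_zero 13)
      (two_le_chainType_one 13)
  have hdegF := hF3.totalDegree hF0
  have hunit : ∀ {G : MvPolynomial (Set.powersetCard (Fin 6) 2) k}, G ≠ 0 → G.totalDegree = 0 →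
      IsUnit G := by
    intro G hG hG0
    rw [totalDegree_eq_zero_iff_eq_C] at hG0
    rw [hG0] at hG ⊢
    rw [Ne, C_eq_zero] at hG
    exact (isUnit_iff_ne_zero.2 hG).map C
  have key : ∀ {G H : MvPolynomial (Set.powersetCard (Fin 6) 2) k}, F = G * H →
      G ∈ projVanishingIdeal (x.exteriorPower 2) (pfaffianLocus k W) → IsUnit H := by
    intro G H hGH hG
    have hG0 : G ≠ 0 := by rintro rfl; exact hF0 (by rw [hGH, zero_mul])
    have hH0 : H ≠ 0 := by rintro rfl; exact hF0 (by rw [hGH, mul_zero])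
    have hdeg := totalDegree_mul_of_isDomain hG0 hH0
    rw [← hGH, hdegF] at hdeg
    refine hunit hH0 ?_
    by_contra hH
    exact hG0 (eq_zero_of_mem_projVanishingIdeal_pfaffianLocus x hG (by omega))
  refine ⟨F, hF3, ⟨fun hu => hprime.ne_top (Ideal.eq_top_of_isUnit_mem _ hmem hu),
    fun G H hGH => ?_⟩, heq⟩
  rcases hprime.mem_or_mem (hGH ▸ hmem) with h | h
  · exact Or.inr (key hGH h)
  · exact Or.inl (key (hGH.trans (mul_comm G H)) h)

end PfaffianIrreducible

/-! ### Standard monomials: counting, independence and straightening -/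

section StandardMonomials

open MvPolynomial

/-- In a linear combination the largest leading monomial that occurs cannot cancel. -/
lemma linearIndependent_of_degree_injective {k σ I : Type*} [Field k] (m : MonomialOrder σ)
    {v : I → MvPolynomial σ k} (h0 : ∀ i, v i ≠ 0)
    (hinj : Function.Injective fun i => m.degree (v i)) : LinearIndependent k v := by
  classical
  rw [linearIndependent_iff']
  intro s g hg
  by_contra! hcon
  obtain ⟨i₀, hi₀, hgi₀⟩ := hcon
  obtain ⟨i, hi, hmax⟩ := (s.filter fun i => g i ≠ 0).exists_max_image
    (fun i => m.toSyn (m.degree (v i))) ⟨i₀, by simp [hi₀, hgi₀]⟩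
  rw [Finset.mem_filter] at hi
  have h1 := congrArg (coeff (m.degree (v i))) hg
  rw [coeff_sum, Finset.sum_eq_single i, coeff_smul, coeff_zero, smul_eq_mul] at h1
  · exact mul_ne_zero hi.2 (m.leadingCoeff_ne_zero_iff.2 (h0 i)) h1
  · intro j hj hji
    rw [coeff_smul, smul_eq_mul]
    by_cases hgj : g j = 0
    · rw [hgj, zero_mul]
    · rw [m.coeff_eq_zero_of_lt, mul_zero]
      refine lt_of_le_of_ne (hmax j (by simp [hj, hgj])) fun h => hji (hinj ?_)
      exact m.toSyn.injective h
  · exact fun h => absurd hi.1 h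

/-- Weakly decreasing lists of `n` increasing pairs below `q`, for the componentwise order:
semistandard tableaux with two rows of length `n`. -/
def standardLists : ℕ → Fin 6 × Fin 6 → Finset (List (Fin 6 × Fin 6))
  | 0, _ => {[]}
  | n + 1, q => (Finset.univ.filter fun p : Fin 6 × Fin 6 => p.1 < p.2 ∧ p ≤ q).biUnion
      fun p => (standardLists n p).map ⟨List.cons p, List.cons_injective⟩

lemma mem_standardLists_succ {n : ℕ} {q : Fin 6 × Fin 6} {l : List (Fin 6 × Fin 6)} :
    l ∈ standardLists (n + 1) q ↔
      ∃ p, p.1 < p.2 ∧ p ≤ q ∧ ∃ t ∈ standardLists n p, l = p :: t := by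
  simp only [standardLists, Finset.mem_biUnion, Finset.mem_filter, Finset.mem_univ, true_and,
    Finset.mem_map, Function.Embedding.coeFn_mk, and_assoc]
  simp only [eq_comm]

lemma length_of_mem_standardLists {n : ℕ} {q : Fin 6 × Fin 6} {l : List (Fin 6 × Fin 6)}
    (hl : l ∈ standardLists n q) : l.length = n := by
  induction n generalizing q l with
  | zero => simp_all [standardLists]
  | succ n ih =>
    obtain ⟨p, -, -, t, ht, rfl⟩ := mem_standardLists_succ.1 hl
    rw [List.length_cons, ih ht]

lemma lt_and_le_of_mem_standardLists {n : ℕ} {q : Fin 6 × Fin 6} {l : List (Fin 6 × Fin 6)}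
    (hl : l ∈ standardLists n q) {p : Fin 6 × Fin 6} (hp : p ∈ l) : p.1 < p.2 ∧ p ≤ q := by
  induction n generalizing q l with
  | zero => simp_all [standardLists]
  | succ n ih =>
    obtain ⟨r, hr, hrq, t, ht, rfl⟩ := mem_standardLists_succ.1 hl
    rcases List.mem_cons.1 hp with rfl | hp
    · exact ⟨hr, hrq⟩
    · exact ⟨(ih ht hp).1, (ih ht hp).2.trans hrq⟩

lemma card_standardLists_succ (n : ℕ) (q : Fin 6 × Fin 6) :
    (standardLists (n + 1) q).card =
      ∑ p ∈ Finset.univ.filter (fun p : Fin 6 × Fin 6 => p.1 < p.2 ∧ p ≤ q),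
        (standardLists n p).card := by
  rw [standardLists, Finset.card_biUnion]
  · simp
  · intro p _ p' _ hpp'
    rw [Function.onFun, Finset.disjoint_left]
    intro l hl hl'
    obtain ⟨t, -, rfl⟩ := Finset.mem_map.1 hl
    obtain ⟨t', -, h⟩ := Finset.mem_map.1 hl'
    exact hpp' (List.cons.inj h).1.symm

/-- The polynomial `t ↦ (t + a).choose a`. -/
def multichoosePoly (a : ℕ) (t : ℚ) : ℚ := ∏ i ∈ Finset.range a, (t + 1 + i) / (i + 1)

/-- The determinantal formula for the number of standard lists. -/
def standardCount (p : Fin 6 × Fin 6) (t : ℚ) : ℚ :=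
  multichoosePoly p.1 t * multichoosePoly p.2 t -
    multichoosePoly p.1 (t + 1) * multichoosePoly p.2 (t - 1)

-- The determinantal formula satisfies the recursion of `card_standardLists_succ`: one polynomial
-- identity in t for each of the fifteen increasing pairs.
set_option maxHeartbeats 4000000 in
lemma sum_standardCount (t : ℚ) (q : Fin 6 × Fin 6) (hq : q.1 < q.2) :
    ∑ p ∈ Finset.univ.filter (fun p : Fin 6 × Fin 6 => p.1 < p.2 ∧ p ≤ q), standardCount p t =
      standardCount q (t + 1) := by
  obtain ⟨a, b⟩ := q
  rw [Finset.sum_filter, Fintype.sum_prod_type]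
  simp only [Fin.sum_univ_six, Prod.mk_le_mk]
  fin_cases a <;> fin_cases b <;> first
    | exact absurd hq (by decide)
    | (simp [standardCount, multichoosePoly, Finset.prod_range_succ, Fin.le_def, Fin.lt_def]
       try ring)

lemma standardCount_zero (q : Fin 6 × Fin 6) (hq : q.1 < q.2) : standardCount q 0 = 1 := by
  obtain ⟨a, b⟩ := q
  fin_cases a <;> fin_cases b <;> first
    | exact absurd hq (by decide)
    | norm_num [standardCount, multichoosePoly, Finset.prod_range_succ]

lemma card_standardLists (n : ℕ) (q : Fin 6 × Fin 6) (hq : q.1 < q.2) :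
    ((standardLists n q).card : ℚ) = standardCount q n := by
  induction n generalizing q with
  | zero => simp [standardLists, standardCount_zero q hq]
  | succ n ih =>
    rw [card_standardLists_succ, Nat.cast_sum, Nat.cast_succ, ← sum_standardCount n q hq]
    refine Finset.sum_congr rfl fun p hp => ih p ?_
    exact (Finset.mem_filter.1 hp).2.1

/-- A totally ordered multiset of increasing pairs can be arranged into a standard list. -/
lemma exists_mem_standardLists {M : Multiset (Fin 6 × Fin 6)} {q : Fin 6 × Fin 6}
    (hM : ∀ p ∈ M, p.1 < p.2 ∧ p ≤ q) (hM' : ∀ p ∈ M, ∀ p' ∈ M, p ≤ p' ∨ p' ≤ p) :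
    ∃ l ∈ standardLists (Multiset.card M) q, (l : Multiset (Fin 6 × Fin 6)) = M := by
  induction hn : Multiset.card M generalizing M q with
  | zero =>
    rw [Multiset.card_eq_zero] at hn
    subst hn
    exact ⟨[], by simp [standardLists], rfl⟩
  | succ n ih =>
    have hne : M.toFinset.Nonempty := by
      rw [Multiset.toFinset_nonempty]
      rintro rfl
      simp at hn
    obtain ⟨p, hp, hmax⟩ := M.toFinset.exists_maximal hne
    rw [Multiset.mem_toFinset] at hp
    have hle : ∀ p' ∈ M, p' ≤ p := by
      intro p' hp'
      rcases hM' p hp p' hp' with h | h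
      · exact hmax (Multiset.mem_toFinset.2 hp') h
      · exact h
    obtain ⟨M, rfl⟩ := Multiset.exists_cons_of_mem hp
    rw [Multiset.card_cons, add_left_inj] at hn
    obtain ⟨l, hl, rfl⟩ := ih
      (fun p' hp' => ⟨(hM p' (Multiset.mem_cons_of_mem hp')).1,
        hle p' (Multiset.mem_cons_of_mem hp')⟩)
      (fun p' hp' p'' hp'' => hM' _ (Multiset.mem_cons_of_mem hp') _ (Multiset.mem_cons_of_mem hp''))
      hn
    exact ⟨p :: l, mem_standardLists_succ.2 ⟨p, (hM p hp).1, (hM p hp).2, l, hl, rfl⟩, rfl⟩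

variable (k : Type*) [Field k]

/-- The `2 × 2` minor of a generic `2 × 6` matrix on the columns `p.1` and `p.2`. -/
noncomputable def genericMinor (p : Fin 6 × Fin 6) : MvPolynomial (Fin 2 ×ₗ Fin 6) k :=
  X (toLex (0, p.1)) * X (toLex (1, p.2)) - X (toLex (0, p.2)) * X (toLex (1, p.1))

/-- The exponent of the leading monomial of a minor. -/
noncomputable def minorExponent (p : Fin 6 × Fin 6) : Fin 2 ×ₗ Fin 6 →₀ ℕ :=
  Finsupp.single (toLex (0, p.1)) 1 + Finsupp.single (toLex (1, p.2)) 1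

/-- The exponents of the two products first differ at the variable (0, p.1), which occurs only in
the diagonal product. -/
lemma degree_genericMinor {p : Fin 6 × Fin 6} (hp : p.1 < p.2) :
    MonomialOrder.lex.degree (genericMinor k p) = minorExponent p := by
  have h1 : ∀ i j : Fin 6, MonomialOrder.lex.degree
      (X (toLex (0, i)) * X (toLex (1, j)) : MvPolynomial (Fin 2 ×ₗ Fin 6) k) =
      minorExponent (i, j) := by
    intro i j
    rw [MonomialOrder.degree_mul (X_ne_zero _) (X_ne_zero _), MonomialOrder.degree_X,
      MonomialOrder.degree_X, minorExponent]
  rw [genericMinor, MonomialOrder.degree_sub_of_lt, h1]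
  rw [h1, h1, MonomialOrder.lex_lt_iff]
  refine ⟨toLex (0, p.1), ?_, ?_⟩
  · intro j hj
    have h2 : ∀ j' : Fin 2 ×ₗ Fin 6, toLex (0, p.1) ≤ j' → Finsupp.single j' 1 j = (0 : ℕ) :=
      fun j' hj' => Finsupp.single_eq_of_ne (hj.trans_le hj').ne
    have h3 : ∀ i : Fin 6, toLex ((0 : Fin 2), p.1) ≤ toLex ((1 : Fin 2), i) :=
      fun i => Prod.Lex.toLex_le_toLex.2 (Or.inl Fin.zero_lt_one)
    have h4 : toLex ((0 : Fin 2), p.1) ≤ toLex ((0 : Fin 2), p.2) :=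
      Prod.Lex.toLex_le_toLex.2 (Or.inr ⟨rfl, hp.le⟩)
    simp [minorExponent, h2 _ le_rfl, h2 _ h4, h2 _ (h3 _)]
  · simp [minorExponent, hp.ne']

lemma genericMinor_ne_zero {p : Fin 6 × Fin 6} (hp : p.1 < p.2) : genericMinor k p ≠ 0 := by
  intro h
  have h1 := degree_genericMinor k hp
  rw [h, MonomialOrder.degree_zero] at h1
  have h2 := DFunLike.congr_fun h1 (toLex (0, p.1))
  simp [minorExponent] at h2

lemma degree_prod_genericMinor {l : List (Fin 6 × Fin 6)} (hl : ∀ p ∈ l, p.1 < p.2) :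
    (l.map (genericMinor k)).prod ≠ 0 ∧
    MonomialOrder.lex.degree (l.map (genericMinor k)).prod = (l.map minorExponent).sum := by
  induction l with
  | nil => simp
  | cons p l ih =>
    obtain ⟨ih1, ih2⟩ := ih fun p' hp' => hl p' (List.mem_cons_of_mem _ hp')
    have hp := hl p List.mem_cons_self
    have hp0 := genericMinor_ne_zero k hp
    simp only [List.map_cons, List.prod_cons, List.sum_cons]
    exact ⟨mul_ne_zero hp0 ih1, by
      rw [MonomialOrder.degree_mul hp0 ih1, ih2, degree_genericMinor k hp]⟩

lemma sum_minorExponent_fst {l : List (Fin 6 × Fin 6)} {i : Fin 6} (hl : ∀ p ∈ l, p.1 ≠ i) :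
    (l.map minorExponent).sum (toLex (0, i)) = 0 := by
  induction l with
  | nil => simp
  | cons p l ih =>
    have hp := hl p List.mem_cons_self
    rw [List.map_cons, List.sum_cons, Finsupp.add_apply,
      ih fun p' hp' => hl p' (List.mem_cons_of_mem _ hp')]
    simp [minorExponent, hp]

lemma sum_minorExponent_snd {l : List (Fin 6 × Fin 6)} {i : Fin 6} (hl : ∀ p ∈ l, p.2 ≠ i) :
    (l.map minorExponent).sum (toLex (1, i)) = 0 := by
  induction l with
  | nil => simp
  | cons p l ih =>
    have hp := hl p List.mem_cons_self
    rw [List.map_cons, List.sum_cons, Finsupp.add_apply,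
      ih fun p' hp' => hl p' (List.mem_cons_of_mem _ hp')]
    simp [minorExponent, hp]

/-- When the head dominates its list, its entries are the largest column indices occurring in the
two rows of the leading monomial. The exponent therefore determines the head, and inductively the
whole standard list. -/
lemma head_le_of_sum_minorExponent_eq {p p' : Fin 6 × Fin 6} {t t' : List (Fin 6 × Fin 6)}
    (h' : ∀ r ∈ p' :: t', r ≤ p')
    (h : ((p :: t).map minorExponent).sum = ((p' :: t').map minorExponent).sum) : p ≤ p' := by
  constructor
  · by_contra hlt
    have h1 := sum_minorExponent_fst (l := p' :: t') (i := p.1)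
      fun r hr hri => hlt (hri ▸ (h' r hr).1)
    rw [← h] at h1
    simp [minorExponent] at h1
  · by_contra hlt
    have h1 := sum_minorExponent_snd (l := p' :: t') (i := p.2)
      fun r hr hri => hlt (hri ▸ (h' r hr).2)
    rw [← h] at h1
    simp [minorExponent] at h1

lemma eq_of_sum_minorExponent_eq {n : ℕ} {q q' : Fin 6 × Fin 6} {l l' : List (Fin 6 × Fin 6)}
    (hl : l ∈ standardLists n q) (hl' : l' ∈ standardLists n q')
    (h : (l.map minorExponent).sum = (l'.map minorExponent).sum) : l = l' := by
  induction n generalizing q q' l l' with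
  | zero => simp_all [standardLists]
  | succ n ih =>
    obtain ⟨p, hp, -, t, ht, rfl⟩ := mem_standardLists_succ.1 hl
    obtain ⟨p', hp', -, t', ht', rfl⟩ := mem_standardLists_succ.1 hl'
    have hle : ∀ {p : Fin 6 × Fin 6} {t : List (Fin 6 × Fin 6)}, t ∈ standardLists n p →
        ∀ r ∈ p :: t, r ≤ p := by
      intro p t ht r hr
      rcases List.mem_cons.1 hr with rfl | hr
      · exact le_rfl
      · exact (lt_and_le_of_mem_standardLists ht hr).2
    obtain rfl : p = p' := le_antisymm (head_le_of_sum_minorExponent_eq (hle ht') h)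
      (head_le_of_sum_minorExponent_eq (hle ht) h.symm)
    simp only [List.map_cons, List.sum_cons, add_right_inj] at h
    rw [ih ht ht' h]

lemma linearIndependent_standardLists (n : ℕ) (q : Fin 6 × Fin 6) :
    LinearIndependent k
      (fun l : standardLists n q => ((l : List (Fin 6 × Fin 6)).map (genericMinor k)).prod) := by
  have hlt : ∀ l ∈ standardLists n q, ∀ p ∈ l, p.1 < p.2 :=
    fun l hl p hp => (lt_and_le_of_mem_standardLists hl hp).1
  refine linearIndependent_of_degree_injective MonomialOrder.lex
    (fun l => (degree_prod_genericMinor k (hlt l l.2)).1) fun l l' h => ?_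
  simp only [(degree_prod_genericMinor k (hlt l l.2)).2,
    (degree_prod_genericMinor k (hlt l' l'.2)).2] at h
  exact Subtype.ext (eq_of_sum_minorExponent_eq l.2 l'.2 h)

/-- For a < c < d < b the left side is a nested, hence incomparable, pair, while both products on
the right involve comparable pairs. -/
lemma plucker_relation (a b c d : Fin 6) :
    genericMinor k (a, b) * genericMinor k (c, d) =
      genericMinor k (a, d) * genericMinor k (c, b) -
        genericMinor k (a, c) * genericMinor k (d, b) := by
  simp only [genericMinor]
  ring

/-- A measure of how far a multiset of pairs is from being totally ordered. -/
def spread (M : Multiset (Fin 6 × Fin 6)) : ℕ :=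
  (M.map fun p => ((p.2 : ℕ) - (p.1 : ℕ)) ^ 2).sum

/-- Straightening: two incomparable pairs are nested, and the Plücker relation replaces them by
pairs with a smaller sum of squared lengths, so induction on `spread` terminates. -/
lemma prod_genericMinor_mem_span {M : Multiset (Fin 6 × Fin 6)} (hM : ∀ p ∈ M, p.1 < p.2)
    {n : ℕ} (hn : Multiset.card M = n) :
    (M.map (genericMinor k)).prod ∈ Submodule.span k (Set.range
      fun l : standardLists n (4, 5) =>
        ((l : List (Fin 6 × Fin 6)).map (genericMinor k)).prod) := by
  induction hN : spread M using Nat.strong_induction_on generalizing M with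
  | h N ih =>
  subst hN
  by_cases hord : ∀ p ∈ M, ∀ p' ∈ M, p ≤ p' ∨ p' ≤ p
  · obtain ⟨l, hl, hlM⟩ := exists_mem_standardLists (q := (4, 5)) (fun p hp => ⟨hM p hp, by
      have := hM p hp
      rw [Prod.le_def]
      simp only [Fin.le_def, Fin.lt_def] at *
      have := p.1.isLt
      have := p.2.isLt
      constructor <;> simp <;> omega⟩) hord
    rw [hn] at hl
    refine Submodule.subset_span ⟨⟨l, hl⟩, ?_⟩
    rw [← hlM, Multiset.map_coe, Multiset.prod_coe]
  · push Not at hord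
    have hnest : ∃ a b c d : Fin 6, (a, b) ∈ M ∧ (c, d) ∈ M ∧ a < c ∧ d < b := by
      obtain ⟨⟨a, b⟩, hp, ⟨c, d⟩, hp', h1, h2⟩ := hord
      simp only [Prod.mk_le_mk, not_and_or, not_le] at h1 h2
      by_cases hac : a < c
      · exact ⟨a, b, c, d, hp, hp', hac, h1.resolve_left (not_lt.2 hac.le)⟩
      · have hbd := h2.resolve_left hac
        exact ⟨c, d, a, b, hp', hp, h1.resolve_right (not_lt.2 hbd.le), hbd⟩
    obtain ⟨a, b, c, d, hab, hcd, hac, hdb⟩ := hnest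
    have hcd' := hM _ hcd
    obtain ⟨M, rfl⟩ := Multiset.exists_cons_of_mem hab
    have hcdM : (c, d) ∈ M := by
      rcases Multiset.mem_cons.1 hcd with h | h
      · simp only [Prod.mk.injEq] at h
        exact absurd h.1 hac.ne'
      · exact h
    obtain ⟨M, rfl⟩ := Multiset.exists_cons_of_mem hcdM
    have hM' : ∀ p ∈ M, p.1 < p.2 := fun p hp =>
      hM p (Multiset.mem_cons_of_mem (Multiset.mem_cons_of_mem hp))
    have key : ∀ a' b' c' d' : Fin 6, a' < b' → c' < d' →
        ((b' : ℕ) - a') ^ 2 + ((d' : ℕ) - c') ^ 2 < ((b : ℕ) - a) ^ 2 + ((d : ℕ) - c) ^ 2 →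
        genericMinor k (a', b') * genericMinor k (c', d') * (M.map (genericMinor k)).prod ∈
          Submodule.span k (Set.range
            fun l : standardLists n (4, 5) =>
            ((l : List (Fin 6 × Fin 6)).map (genericMinor k)).prod) := by
      intro a' b' c' d' h1 h2 h3
      have h4 : ∀ p ∈ (a', b') ::ₘ (c', d') ::ₘ M, p.1 < p.2 := by
        intro p hp
        simp only [Multiset.mem_cons] at hp
        rcases hp with rfl | rfl | hp
        · exact h1
        · exact h2
        · exact hM' p hp
      have h5 := ih (spread ((a', b') ::ₘ (c', d') ::ₘ M)) (by
        simp only [spread, Multiset.map_cons, Multiset.sum_cons]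
        omega) h4 (by simpa using hn) rfl
      simpa only [Multiset.map_cons, Multiset.prod_cons, ← mul_assoc] using h5
    simp only [Multiset.map_cons, Multiset.prod_cons, ← mul_assoc]
    rw [plucker_relation, sub_mul]
    have hcd'' : c < d := hcd'
    rw [Fin.lt_def] at hac hdb hcd''
    -- The gaps of a < c < d < b are u + 1, v + 1, w + 1; writing all lengths through them removes
    -- the truncated subtractions.
    obtain ⟨u, hu⟩ := Nat.exists_eq_add_of_lt hac
    obtain ⟨v, hv⟩ := Nat.exists_eq_add_of_lt hcd''
    obtain ⟨w, hw⟩ := Nat.exists_eq_add_of_lt hdb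
    refine Submodule.sub_mem _ (key a d c b (by rw [Fin.lt_def]; omega)
      (by rw [Fin.lt_def]; omega) ?_) (key a c d b (by rw [Fin.lt_def]; omega)
      (by rw [Fin.lt_def]; omega) ?_)
    · rw [show (d : ℕ) - a = u + v + 2 by omega, show (b : ℕ) - c = v + w + 2 by omega,
        show (b : ℕ) - a = u + v + w + 3 by omega, show (d : ℕ) - c = v + 1 by omega]
      nlinarith
    · rw [show (c : ℕ) - a = u + 1 by omega, show (b : ℕ) - d = w + 1 by omega,
        show (b : ℕ) - a = u + v + w + 3 by omega, show (d : ℕ) - c = v + 1 by omega]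
      nlinarith

end StandardMonomials

/-! ### Hilbert function and degree of the Grassmannian -/

section Degree

open MvPolynomial

variable (k : Type*) [Field k]

/-- Monomials of degree n map to products of n minors, which straightening expresses through
standard ones; conversely every standard product is the image of a monomial. -/
lemma map_homogeneousSubmodule_aeval_genericMinor (n : ℕ) :
    (homogeneousSubmodule (Set.powersetCard (Fin 6) 2) k n).map
      (aeval (R := k) fun P => genericMinor k (pairFst P, pairSnd P)).toLinearMap =
    Submodule.span k (Set.range fun l : standardLists n (4, 5) =>
      ((l : List (Fin 6 × Fin 6)).map (genericMinor k)).prod) := by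
  apply le_antisymm
  · rintro _ ⟨f, hf, rfl⟩
    rw [AlgHom.toLinearMap_apply, aeval_def, eval₂_eq]
    refine Submodule.sum_mem _ fun d hd => ?_
    rw [← Algebra.smul_def]
    refine Submodule.smul_mem _ _ ?_
    have hd' : d.degree = n := by
      rw [Finsupp.degree_eq_weight_one]
      exact hf (mem_support_iff.1 hd)
    have h := prod_genericMinor_mem_span k
      (M := (Finsupp.toMultiset d).map fun P => (pairFst P, pairSnd P)) (n := n)
      (by
        intro p hp
        obtain ⟨P, -, rfl⟩ := Multiset.mem_map.1 hp
        exact pairFst_lt_pairSnd P)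
      (by rw [Multiset.card_map, Finsupp.card_toMultiset, ← hd']; rfl)
    rw [Multiset.map_map, Finsupp.toMultiset_map, Finsupp.prod_toMultiset,
      Finsupp.prod_mapDomain_index (fun _ => pow_zero _) (fun _ _ _ => pow_add _ _ _)] at h
    exact h
  · rw [Submodule.span_le]
    rintro _ ⟨⟨l, hl⟩, rfl⟩
    have hlen := length_of_mem_standardLists hl
    have hlt : ∀ p ∈ l, p.1 < p.2 := fun p hp => (lt_and_le_of_mem_standardLists hl hp).1
    change (l.map (genericMinor k)).prod ∈ _
    clear hl
    subst hlen
    induction l with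
    | nil => exact ⟨1, isHomogeneous_one _ _, by simp⟩
    | cons p l ih =>
      obtain ⟨f, hf, hfl⟩ := ih fun p' hp' => hlt p' (List.mem_cons_of_mem _ hp')
      refine ⟨X (pairMk p.1 p.2 (hlt p List.mem_cons_self)) * f, ?_, ?_⟩
      · rw [List.length_cons, add_comm]
        exact (isHomogeneous_X _ _).mul hf
      · rw [AlgHom.toLinearMap_apply] at hfl ⊢
        rw [map_mul, aeval_X, hfl, pairFst_pairMk, pairSnd_pairMk, List.map_cons, List.prod_cons]

variable {k}

/-- The quotient by the kernel embeds in B, so graded pieces of the coordinate ring can be measured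
among polynomials in the matrix entries. -/
lemma finrank_map_mkₐ_of_eq_ker {A B : Type*} [CommRing A] [Algebra k A] [CommRing B] [Algebra k B]
    (Φ : A →ₐ[k] B) {I : Ideal A} (hI : I = RingHom.ker Φ) (S : Submodule k A) :
    Module.finrank k (S.map (Ideal.Quotient.mkₐ k I).toLinearMap) =
      Module.finrank k (S.map Φ.toLinearMap) := by
  subst hI
  have h : Φ.toLinearMap = (Ideal.kerLiftAlg Φ).toLinearMap ∘ₗ
      (Ideal.Quotient.mkₐ k (RingHom.ker Φ)).toLinearMap := by
    ext a
    simp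
  rw [h, Submodule.map_comp]
  exact (Submodule.equivMapOfInjective _ (Ideal.kerLiftAlg_injective Φ) _).finrank_eq

variable {W : Type*} [AddCommGroup W] [Module k W] (x : Module.Basis (Fin 6) k W)

lemma projVanishingIdeal_lineGrassmannian [Infinite k] :
    projVanishingIdeal (x.exteriorPower 2) (lineGrassmannian k W) =
      RingHom.ker (aeval (R := k) fun P => genericMinor k (pairFst P, pairSnd P)) := by
  rw [lineGrassmannian_eq_coneLocus x]
  have hT : bivectorCone x (chainType 8) = {φ | IsWedgeSum 1 φ} := bivectorCone_chainType_eight x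
  refine projVanishingIdeal_coneLocus_eq_ker (isCone_bivectorCone x _)
    (exists_ne_zero_mem_bivectorCone x (one_le_chainType_zero 8) (two_le_chainType_one 8)) _ ?_ ?_
  · rw [hT]
    intro φ hφ
    obtain ⟨a, c, rfl⟩ := isWedgeSum_one_iff.1 hφ
    refine ⟨fun i => x.repr (if (ofLex i).1 = 0 then a else c) (ofLex i).2, fun P => ?_⟩
    simp [exteriorPower_repr_wedge, genericMinor]
  · rw [hT]
    intro y
    refine ⟨wedge (∑ i, y (toLex (0, i)) • x i) (∑ i, y (toLex (1, i)) • x i),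
      isWedgeSum_one_iff.2 ⟨_, _, rfl⟩, fun P => ?_⟩
    simp only [exteriorPower_repr_wedge, Module.Basis.repr_sum_self, genericMinor, map_sub, map_mul,
      eval_X]

lemma projHilbertFunction_lineGrassmannian [Infinite k] (n : ℕ) :
    (projHilbertFunction (x.exteriorPower 2) (lineGrassmannian k W) n : ℚ) =
      standardCount (4, 5) n := by
  rw [← card_standardLists n (4, 5) (by decide), projHilbertFunction,
    finrank_map_mkₐ_of_eq_ker _ (projVanishingIdeal_lineGrassmannian x),
    map_homogeneousSubmodule_aeval_genericMinor,
    finrank_span_eq_card (linearIndependent_standardLists k n (4, 5)), Fintype.card_coe]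

lemma hasProjDegree_lineGrassmannian [Infinite k] :
    HasProjDegree (x.exteriorPower 2) (lineGrassmannian k W) 14 := by
  have hdeg : ∀ a : ℚ, (Polynomial.X + Polynomial.C a).natDegree = 1 := Polynomial.natDegree_X_add_C
  let Q : Polynomial ℚ := (Polynomial.X + Polynomial.C 1) * (Polynomial.X + Polynomial.C 2) ^ 2 *
    (Polynomial.X + Polynomial.C 3) ^ 2 * (Polynomial.X + Polynomial.C 4) ^ 2 *
    (Polynomial.X + Polynomial.C 5)
  have hQ : Q.Monic := by
    have h := fun a : ℚ => Polynomial.monic_X_add_C a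
    exact ((((h 1).mul ((h 2).pow 2)).mul ((h 3).pow 2)).mul ((h 4).pow 2)).mul (h 5)
  have hQ' : Q.natDegree = 8 := by
    simp only [Q]
    compute_degree!
  -- The Hilbert polynomial is (n+1)(n+2)²(n+3)²(n+4)²(n+5)/2880, and 8!/2880 = 14.
  refine ⟨Polynomial.C (1 / 2880) * Q, Filter.Eventually.of_forall fun n => ?_, ?_⟩
  · rw [projHilbertFunction_lineGrassmannian]
    simp [standardCount, multichoosePoly, Finset.prod_range_succ, Q]
    ring
  · rw [Polynomial.natDegree_C_mul (by norm_num), hQ', Polynomial.leadingCoeff_mul,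
      hQ.leadingCoeff, Polynomial.leadingCoeff_C]
    norm_num [Nat.factorial]

end Degree

/-! ### The proposition -/

theorem proposition3p1 {k W : Type*} [Field k] [IsAlgClosed k] [CharZero k]
    [AddCommGroup W] [Module k W] (x : Module.Basis (Fin 6) k W) :
    -- the Grassmannian is the locus of bivectors of rank 2, and is defined by `φ ^ 2 = 0`
    (lineGrassmannian k W = {p | bivectorRank p.rep = 2} ∧
      lineGrassmannian k W = {p | (p.rep : ExteriorAlgebra k W) ^ 2 = 0}) ∧
    -- it is a smooth variety of dimension 8 and degree 14
    (IsProjVariety (x.exteriorPower 2) (lineGrassmannian k W) ∧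
      (∀ p ∈ lineGrassmannian k W, IsSmoothPoint (x.exteriorPower 2) (lineGrassmannian k W) p) ∧
      projDim (x.exteriorPower 2) (lineGrassmannian k W) = 8 ∧
      HasProjDegree (x.exteriorPower 2) (lineGrassmannian k W) 14) ∧
    -- the Pfaffian locus is the locus of bivectors of rank at most 4
    pfaffianLocus k W = {p | bivectorRank p.rep ≤ 4} ∧
    -- it is an irreducible cubic hypersurface
    (IsProjVariety (x.exteriorPower 2) (pfaffianLocus k W) ∧
      IsIrreducibleHypersurface (x.exteriorPower 2) (pfaffianLocus k W) 3) ∧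
    -- its singular points are the points of the Grassmannian
    singularPoints (x.exteriorPower 2) (pfaffianLocus k W) = lineGrassmannian k W := by
  have hW : Module.finrank k W = 6 := by rw [Module.finrank_eq_card_basis x, Fintype.card_fin]
  have : Module.Finite k W := Module.Finite.of_basis x
  have hG2 := lineGrassmannian_eq_pow_two (k := k) (W := W) hW
  have hGcl : @IsClosed _ (projZariskiTopology (x.exteriorPower 2)) (lineGrassmannian k W) := by
    rw [hG2]
    exact isClosed_pow_eq_zero _ 2
  have hCcl : @IsClosed _ (projZariskiTopology (x.exteriorPower 2)) (pfaffianLocus k W) :=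
    isClosed_pow_eq_zero _ 3
  have hGirr : @IsIrreducible _ (projZariskiTopology (x.exteriorPower 2))
      (lineGrassmannian k W) := by
    refine isIrreducible_of_isPrime_projVanishingIdeal ?_
    rw [lineGrassmannian_eq_coneLocus x]
    exact isPrime_projVanishingIdeal_bivectorCone x (one_le_chainType_zero 8)
      (two_le_chainType_one 8)
  have hCirr : @IsIrreducible _ (projZariskiTopology (x.exteriorPower 2))
      (pfaffianLocus k W) := by
    refine isIrreducible_of_isPrime_projVanishingIdeal ?_
    rw [pfaffianLocus_eq_coneLocus x]
    exact isPrime_projVanishingIdeal_bivectorCone x (one_le_chainType_zero 13)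
      (two_le_chainType_one 13)
  have hGdim : projDim (x.exteriorPower 2) (lineGrassmannian k W) = 8 := by
    rw [lineGrassmannian_eq_coneLocus x] at hGcl ⊢
    exact projDim_chain x (by norm_num) hGcl
  have hCdim : projDim (x.exteriorPower 2) (pfaffianLocus k W) = 13 := by
    have h := hCcl
    rw [pfaffianLocus_eq_coneLocus x] at h ⊢
    exact projDim_chain x le_rfl h
  have hGC : lineGrassmannian k W ⊆ pfaffianLocus k W := by
    rw [hG2]
    intro p hp
    change (p.rep : ExteriorAlgebra k W) ^ 3 = 0
    rw [pow_succ, show (p.rep : ExteriorAlgebra k W) ^ 2 = 0 from hp, zero_mul]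
  refine ⟨⟨?_, hG2⟩, ⟨⟨hGcl, hGirr⟩, fun p hp => ⟨hp, ?_⟩, hGdim,
    hasProjDegree_lineGrassmannian x⟩, ?_, ⟨⟨hCcl, hCirr⟩,
    isIrreducibleHypersurface_pfaffianLocus x⟩, ?_⟩
  · ext p
    exact mem_lineGrassmannian_iff.trans (bivectorRank_eq_two_iff p.rep_nonzero).symm
  · rw [finrank_projTangentSpace_lineGrassmannian x hp, hGdim]
    norm_num
  · ext p
    exact (pow_three_eq_zero_iff hW).trans (bivectorRank_le_iff (n := 4)).symm
  · ext p
    constructor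
    · rintro ⟨hp, hns⟩
      by_contra hpG
      refine hns ⟨hp, ?_⟩
      rw [finrank_projTangentSpace_pfaffianLocus x hp hpG, hCdim]
      norm_num
    · refine fun hp => ⟨hGC hp, fun hs => ?_⟩
      -- Smoothness at a point of the Grassmannian would require 15 = 13 + 1.
      have h := hs.2
      rw [projTangentSpace_pfaffianLocus_of_mem_lineGrassmannian x hp, finrank_top,
        exteriorPower.finrank_eq, hW, hCdim] at h
      revert h
      norm_num [Nat.choose]
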